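/- Let $\Bbbk$ be a field and let $H$ be a Hopf algebra over $\Bbbk$, with comultiplication $\Delta(a)=a_1\otimes a_2$ (Sweedler notation), counit $\varepsilon$ and antipode $S$. Assume that $H$ is left and right noetherian and Artin–Schelter Gorenstein of injective dimension $d$, that is, 1. the left module ${}_HH$ has injective dimension $d<\infty$; 2. $\operatorname{Ext}^i_H({}_\varepsilon\Bbbk,H)=0$ for $i\neq d$ and $\dim_\Bbbk\operatorname{Ext}^d_H({}_\varepsilon\Bbbk,H)=1$, where ${}_\varepsilon\Bbbk$ is the trivial left module; 3. the analogues of 1 and 2 for right $H$-modules hold, with the same $d$. The left homological integral of $H$ is $\int^\ell=\operatorname{Ext}^d_H({}_\varepsilon\Bbbk,H)$ with the right $H$-module structure induced by right multiplication on the second argument. Then there is exactly one algebra homomorphism $\chi:H\to\Bbbk$ such that $e\cdot h=\chi(h)e$ for all $e\in\int^\ell$ and $h\in H$. Let $$\xi(a)=\chi(a_1)a_2,\qquad \phi(a)=a_1\chi(a_2)\qquad(a\in H)$$ be the left and right winding automorphisms of $H$ given by $\chi$. Then there is an inner automorphism $\gamma$ of $H$ (conjugation by a unit of $H$) such that $$S^4=\gamma\circ\phi\circ\xi^{-1}.$$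 -/

import Mathlib

open CategoryTheory CategoryTheory.Abelian

universe u

noncomputable section

namespace ASHopf

/-! ### Winding automorphisms -/

section Winding

variable (k : Type u) {H : Type u} [Field k] [Ring H] [HopfAlgebra k H]

/-- The composite `χ ∘ S` of a character `χ` with the antipode; it is again a character. -/
def characterAntipode (χ : H →ₐ[k] k) : H →ₐ[k] k :=
  AlgHom.ofLinearMap (χ.toLinearMap ∘ₗ HopfAlgebra.antipode k)
    (by simp)
    (fun x y => by simp [HopfAlgebra.antipode_mul_antidistrib, mul_comm])

/-- The algebra map `a ↦ χ(a₁) a₂`. -/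
def leftWindingHom (χ : H →ₐ[k] k) : H →ₐ[k] H :=
  (Algebra.TensorProduct.lid k H).toAlgHom.comp
    ((Algebra.TensorProduct.map χ (AlgHom.id k H)).comp (Bialgebra.comulAlgHom k H))

/-- The algebra map `a ↦ a₁ χ(a₂)`. -/
def rightWindingHom (χ : H →ₐ[k] k) : H →ₐ[k] H :=
  (Algebra.TensorProduct.rid k k H).toAlgHom.comp
    ((Algebra.TensorProduct.map (AlgHom.id k H) χ).comp (Bialgebra.comulAlgHom k H))

/-- A character viewed as an `H`-valued algebra map. -/
def characterToSelf (χ : H →ₐ[k] k) : H →ₐ[k] H := (Algebra.ofId k H).comp χ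

theorem toConv_leftWindingHom (χ : H →ₐ[k] k) :
    WithConv.toConv (leftWindingHom k χ).toLinearMap =
      WithConv.toConv (characterToSelf k χ).toLinearMap *
        WithConv.toConv (LinearMap.id : H →ₗ[k] H) := by
  ext a
  have e := Coalgebra.Repr.eq (Coalgebra.Repr.arbitrary k a)
  rw [(Coalgebra.Repr.arbitrary k a).convMul_apply]
  simp [leftWindingHom, characterToSelf, ← e, Algebra.smul_def, Algebra.ofId_apply]

theorem toConv_rightWindingHom (χ : H →ₐ[k] k) :
    WithConv.toConv (rightWindingHom k χ).toLinearMap =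
      WithConv.toConv (LinearMap.id : H →ₗ[k] H) *
        WithConv.toConv (characterToSelf k χ).toLinearMap := by
  ext a
  have e := Coalgebra.Repr.eq (Coalgebra.Repr.arbitrary k a)
  rw [(Coalgebra.Repr.arbitrary k a).convMul_apply]
  simp [rightWindingHom, characterToSelf, ← e, Algebra.smul_def, Algebra.ofId_apply,
    Algebra.commutes]

theorem character_mul_antipode (χ : H →ₐ[k] k) :
    WithConv.toConv (characterToSelf k χ).toLinearMap *
      WithConv.toConv (characterToSelf k (characterAntipode k χ)).toLinearMap = 1 := by
  have h := LinearMap.algHom_comp_convMul_distrib (characterToSelf k χ)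
    (WithConv.toConv (LinearMap.id : H →ₗ[k] H)) (WithConv.toConv (HopfAlgebra.antipode k))
  rw [LinearMap.id_mul_antipode] at h
  have h' := congrArg WithConv.toConv h
  refine Eq.trans h'.symm ?_
  ext a
  simp [characterToSelf, LinearMap.convOne_def, Algebra.ofId_apply]

theorem antipode_mul_character (χ : H →ₐ[k] k) :
    WithConv.toConv (characterToSelf k (characterAntipode k χ)).toLinearMap *
      WithConv.toConv (characterToSelf k χ).toLinearMap = 1 := by
  have h := LinearMap.algHom_comp_convMul_distrib (characterToSelf k χ)
    (WithConv.toConv (HopfAlgebra.antipode k)) (WithConv.toConv (LinearMap.id : H →ₗ[k] H))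
  rw [LinearMap.antipode_mul_id] at h
  have h' := congrArg WithConv.toConv h
  refine Eq.trans h'.symm ?_
  ext a
  simp [characterToSelf, LinearMap.convOne_def, Algebra.ofId_apply]

theorem leftWindingHom_comp (χ ψ : H →ₐ[k] k)
    (h : WithConv.toConv (characterToSelf k χ).toLinearMap *
      WithConv.toConv (characterToSelf k ψ).toLinearMap = 1) :
    (leftWindingHom k ψ).comp (leftWindingHom k χ) = AlgHom.id k H := by
  apply AlgHom.toLinearMap_injective
  apply WithConv.toConv_injective
  have h1 := congrArg WithConv.toConv (LinearMap.algHom_comp_convMul_distrib (leftWindingHom k ψ)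
    (WithConv.toConv (characterToSelf k χ).toLinearMap)
    (WithConv.toConv (LinearMap.id : H →ₗ[k] H)))
  rw [← toConv_leftWindingHom] at h1
  refine Eq.trans h1 ?_
  have h2 : (leftWindingHom k ψ).toLinearMap ∘ₗ (characterToSelf k χ).toLinearMap =
      (characterToSelf k χ).toLinearMap := by
    ext a
    simp [characterToSelf, Algebra.ofId_apply]
  simp only [WithConv.toConv_ofConv, LinearMap.comp_id, h2]
  rw [toConv_leftWindingHom, ← mul_assoc, h, one_mul]
  rfl

theorem rightWindingHom_comp (χ ψ : H →ₐ[k] k)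
    (h : WithConv.toConv (characterToSelf k ψ).toLinearMap *
      WithConv.toConv (characterToSelf k χ).toLinearMap = 1) :
    (rightWindingHom k ψ).comp (rightWindingHom k χ) = AlgHom.id k H := by
  apply AlgHom.toLinearMap_injective
  apply WithConv.toConv_injective
  have h1 := congrArg WithConv.toConv (LinearMap.algHom_comp_convMul_distrib (rightWindingHom k ψ)
    (WithConv.toConv (LinearMap.id : H →ₗ[k] H))
    (WithConv.toConv (characterToSelf k χ).toLinearMap))
  rw [← toConv_rightWindingHom] at h1
  refine Eq.trans h1 ?_
  have h2 : (rightWindingHom k ψ).toLinearMap ∘ₗ (characterToSelf k χ).toLinearMap =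
      (characterToSelf k χ).toLinearMap := by
    ext a
    simp [characterToSelf, Algebra.ofId_apply]
  simp only [WithConv.toConv_ofConv, LinearMap.comp_id, h2]
  rw [toConv_rightWindingHom, mul_assoc, h, mul_one]
  rfl

/-- The left winding automorphism `a ↦ χ(a₁) a₂`, with inverse `a ↦ χ(S(a₁)) a₂`. -/
def leftWinding (χ : H →ₐ[k] k) : H ≃ₐ[k] H :=
  AlgEquiv.ofAlgHom (leftWindingHom k χ) (leftWindingHom k (characterAntipode k χ))
    (leftWindingHom_comp k _ _ (antipode_mul_character k χ))
    (leftWindingHom_comp k _ _ (character_mul_antipode k χ))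

/-- The right winding automorphism `a ↦ a₁ χ(a₂)`, with inverse `a ↦ a₁ χ(S(a₂))`. -/
def rightWinding (χ : H →ₐ[k] k) : H ≃ₐ[k] H :=
  AlgEquiv.ofAlgHom (rightWindingHom k χ) (rightWindingHom k (characterAntipode k χ))
    (rightWindingHom_comp k _ _ (character_mul_antipode k χ))
    (rightWindingHom_comp k _ _ (antipode_mul_character k χ))

end Winding

/-- An automorphism of an algebra is inner if it is conjugation by a unit. -/
def IsInnerAut (k : Type u) {H : Type u} [Field k] [Ring H] [Algebra k H] (γ : H ≃ₐ[k] H) : Prop :=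
  ∃ v : Hˣ, ∀ a : H, γ a = ↑v * a * ↑v⁻¹

/-! ### Trivial modules, the groups `Ext`, and the Artin–Schelter–Gorenstein condition -/

section Gorenstein

variable (k H : Type u) [Field k] [Ring H] [HopfAlgebra k H]

/-- The trivial left module: `k`, on which `h` acts as multiplication by `ε(h)`. -/
def trivialLeft : ModuleCat.{u} H :=
  (ModuleCat.restrictScalars (Bialgebra.counitAlgHom k H : H →+* k)).obj (ModuleCat.of k k)

/-- The trivial right module, as a left module over the opposite algebra. -/
def trivialRight : ModuleCat.{u} Hᵐᵒᵖ :=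
  (ModuleCat.restrictScalars
    ((Bialgebra.counitAlgHom k H).fromOpposite (fun _ _ => Commute.all _ _) : Hᵐᵒᵖ →+* k)).obj
    (ModuleCat.of k k)

/-- `Ext` of degree `i` of left `H`-modules from the trivial module to `H`. -/
def LeftExt (i : ℕ) : Type u := Ext.{u} (trivialLeft k H) (ModuleCat.of H H) i

/-- `Ext` of degree `i` of right `H`-modules from the trivial module to `H`. -/
def RightExt (i : ℕ) : Type u := Ext.{u} (trivialRight k H) (ModuleCat.of Hᵐᵒᵖ H) i

instance (i : ℕ) : AddCommGroup (LeftExt k H i) :=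
  inferInstanceAs (AddCommGroup (Ext.{u} (trivialLeft k H) (ModuleCat.of H H) i))

instance (i : ℕ) : Module k (LeftExt k H i) :=
  inferInstanceAs (Module k (Ext.{u} (trivialLeft k H) (ModuleCat.of H H) i))

instance (i : ℕ) : AddCommGroup (RightExt k H i) :=
  inferInstanceAs (AddCommGroup (Ext.{u} (trivialRight k H) (ModuleCat.of Hᵐᵒᵖ H) i))

instance (i : ℕ) : Module k (RightExt k H i) :=
  inferInstanceAs (Module k (Ext.{u} (trivialRight k H) (ModuleCat.of Hᵐᵒᵖ H) i))

/-- Right multiplication `x ↦ x * h`, an endomorphism of the left module `H`. -/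
def rightMul {H : Type u} [Ring H] (h : H) : ModuleCat.of H H ⟶ ModuleCat.of H H :=
  ModuleCat.ofHom (LinearMap.toSpanSingleton H H h)

/-- The right `H`-module structure on `Ext` induced by right multiplication on the
second argument. -/
instance (i : ℕ) : Module Hᵐᵒᵖ (LeftExt k H i) where
  smul h e := Ext.comp (Y := ModuleCat.of H H) e (Ext.mk₀ (rightMul h.unop)) (add_zero i)
  one_smul e := by
    have h1 : rightMul (1 : H) = 𝟙 (ModuleCat.of H H) := by
      ext; simp [rightMul]
    change Ext.comp (Y := ModuleCat.of H H) e (Ext.mk₀ (rightMul (1 : H))) (add_zero i) = e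
    rw [h1]
    exact Ext.comp_mk₀_id _
  mul_smul a b e := by
    have h1 : rightMul (a * b).unop = rightMul b.unop ≫ rightMul a.unop := by
      ext; simp [rightMul]
    change Ext.comp (Y := ModuleCat.of H H) e (Ext.mk₀ (rightMul (a * b).unop)) (add_zero i) =
      Ext.comp (Y := ModuleCat.of H H)
        (Ext.comp (Y := ModuleCat.of H H) e (Ext.mk₀ (rightMul b.unop)) (add_zero i))
        (Ext.mk₀ (rightMul a.unop)) (add_zero i)
    rw [h1, ← Ext.mk₀_comp_mk₀]
    exact (Ext.comp_assoc _ _ _ (add_zero i) (add_zero 0) (by omega)).symm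
  smul_zero a := Ext.zero_comp _ _ (Ext.mk₀ (rightMul a.unop)) _ (add_zero i)
  smul_add a x y := Ext.add_comp _ _ _ _
  add_smul a b e := by
    have h1 : rightMul (a + b).unop = rightMul a.unop + rightMul b.unop := by
      ext; simp [rightMul]
    change Ext.comp (Y := ModuleCat.of H H) e (Ext.mk₀ (rightMul (a + b).unop)) (add_zero i) = _
    rw [h1, Ext.mk₀_add]
    exact Ext.comp_add _ _ _ _
  zero_smul e := by
    have h1 : rightMul (0 : Hᵐᵒᵖ).unop = (0 : ModuleCat.of H H ⟶ ModuleCat.of H H) := by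
      ext; simp [rightMul]
    change Ext.comp (Y := ModuleCat.of H H) e
      (Ext.mk₀ (rightMul (0 : Hᵐᵒᵖ).unop)) (add_zero i) = 0
    rw [h1, Ext.mk₀_zero]
    exact Ext.comp_zero _ _ _ _ (add_zero i)

/-- `H` is Artin–Schelter Gorenstein of injective dimension `d`. -/
structure IsASGorenstein (d : ℕ) : Prop where
  injDim_left : injectiveDimension (ModuleCat.of H H) = d
  ext_left : ∀ i : ℕ, i ≠ d → Subsingleton (LeftExt k H i)
  finrank_left : Module.finrank k (LeftExt k H d) = 1
  injDim_right : injectiveDimension (ModuleCat.of Hᵐᵒᵖ H) = d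
  ext_right : ∀ i : ℕ, i ≠ d → Subsingleton (RightExt k H i)
  finrank_right : Module.finrank k (RightExt k H d) = 1

variable {k H} in
/-- The right `H`-module structure of the left homological integral, the degree `d` group
`LeftExt k H d`, is given by the character `χ`. -/
def IsLeftIntegralCharacter (d : ℕ) (χ : H →ₐ[k] k) : Prop :=
  ∀ (e : LeftExt k H d) (h : H), MulOpposite.op h • e = χ h • e

end Gorenstein

end ASHopf

end

/-!
The proof compares two computations of one bimodule. Let `A = H ⊗ Hᵐᵒᵖ` be the enveloping algebra,
let `H` be the regular bimodule, viewed as a left `A`-module, and let `E = Ext_A^d(H, A)`, on which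
`A` acts from the right through its right multiplications.

Restriction along the algebra map `H → A`, `h ↦ h₁ ⊗ S(h₂)`, sends a bimodule to a left module with
the adjoint action, and bimodule maps out of `H` are the same as module maps from the trivial module
to the adjoint module. Since `A` is free as a right `H`-module, restriction preserves injectives, so
`E` is `Ext_H^d(k, A)` (`extComparison_bijective`, `preservesInjectiveObjects_of_rightSpan`). Since
`A` is also free as a left `H`-module, on a copy of `H`, and `H` is left noetherian, this is
`Ext_H^d(k, H) ⊗ H`, a copy of `H` (`extSum_bijective`, `pushExt_bijective`). Keeping track of the
right action one finds `y · (a ⊗ b) = b y S²(ξ(a))` (`exists_ext_equiv_left`). Right modules and the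
map `h ↦ S(h₁) ⊗ h₂` give in the same way a second copy of `H`, with action
`x · (a ⊗ b) = S²(φ'(b)) x a`, where `φ'` is the right winding by the character `χ'` of the right
integral (`exists_ext_equiv_right`). All of this uses only the convolution inverses of algebra maps,
so the antipode is not assumed to be bijective.

Comparing the two yields an additive bijection `θ` of `H` with
`θ(b y S²(ξ(a))) = S²(φ'(b)) θ(y) a`. The element `w = θ(1)` is a unit, because it is left
invertible and `H` is noetherian, and `S²φ'S²ξ(a) = w a w⁻¹`. Windings commute with `S²`, so
`S⁴φ'ξ` is inner; the counit of this identity says that `χ'` is the convolution inverse of `χ`,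
that is, `φ' = φ⁻¹` (`exists_inner_of_twist_equiv`).
-/

noncomputable section

namespace ASHopf

open scoped TensorProduct
open Coalgebra HopfAlgebra

/-! ### Exact functors and `Ext` -/

section ExactFunctor

open Limits

universe w w' v v' u₁ u₂

variable {C : Type u₁} [Category.{v} C] [Abelian C] [HasExt.{w} C]
  {D : Type u₂} [Category.{v'} D] [Abelian D] [HasExt.{w'} D]
  (F : C ⥤ D) [F.Additive] [PreservesFiniteLimits F] [PreservesFiniteColimits F]
  {N : C} {K : D} (η : K ⟶ F.obj N)

/-- The comparison map `Ext N M n → Ext K (F M) n` given by an exact functor `F` and a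
morphism `η : K ⟶ F N`. -/
def extComparison (M : C) (n : ℕ) : Ext.{w} N M n →+ Ext.{w'} K (F.obj M) n :=
  ((Ext.mk₀ η).precomp (F.obj M) (zero_add n)).comp (F.mapExtAddHom N M n)

theorem extComparison_apply (M : C) (n : ℕ) (e : Ext.{w} N M n) :
    extComparison F η M n e = (Ext.mk₀ η).comp (e.mapExactFunctor F) (zero_add n) := rfl

theorem extComparison_comp {M M' : C} {n m p : ℕ} (e : Ext.{w} N M n) (x : Ext.{w} M M' m)
    (h : n + m = p) :
    extComparison F η M' p (e.comp x h) =
      (extComparison F η M n e).comp (x.mapExactFunctor F) h := by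
  rw [extComparison_apply, extComparison_apply, Ext.mapExactFunctor_comp]
  exact (Ext.comp_assoc _ _ _ (zero_add n) h (by omega)).symm

attribute [local instance] Ext.subsingleton_of_injective in
/-- If `F` preserves injectives and `η` exhibits `N` as corepresenting `Hom K (F -)`, then `η`
computes `Ext K (F -)` as `Ext N` in every degree: both sides vanish in positive degree on
injectives, so the degree zero bijection propagates by dimension shifting. -/
theorem extComparison_bijective [EnoughInjectives C] [F.PreservesInjectiveObjects]
    (hη : ∀ M : C, Function.Bijective fun f : N ⟶ M => η ≫ F.map f) (M : C) (n : ℕ) :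
    Function.Bijective (extComparison F η M n) := by
  induction n generalizing M with
  | zero =>
    have h : ⇑(extComparison F η M 0) =
        Ext.mk₀ ∘ (fun f : N ⟶ M => η ≫ F.map f) ∘ Ext.homEquiv₀ := by
      ext e
      obtain ⟨f, rfl⟩ := (Ext.mk₀_bijective N M).2 e
      simp [extComparison_apply, Ext.mapExactFunctor_mk₀, Ext.homEquiv₀]
    rw [h]
    exact (Ext.mk₀_bijective _ _).comp ((hη M).comp Ext.homEquiv₀.bijective)
  | succ n hn =>
    let I : InjectivePresentation M := Classical.arbitrary _
    let S := ShortComplex.mk _ _ (cokernel.condition I.f)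
    have : Injective (S.map F).X₂ := Functor.PreservesInjectiveObjects.injective_obj I.injective
    have hS : S.ShortExact := { exact := ShortComplex.exact_cokernel I.f }
    refine AddMonoidHom.bijective_of_surjective_of_bijective_of_right_exact
      ((Ext.mk₀ S.g).postcomp N (add_zero n)) (hS.extClass.postcomp N rfl)
      ((Ext.mk₀ (S.map F).g).postcomp K (add_zero n))
      ((hS.map_of_exact F).extClass.postcomp K rfl)
      (extComparison F η S.X₂ n) (extComparison F η S.X₃ n) (extComparison F η S.X₁ (n + 1))
      ?_ ?_ ((ShortComplex.ab_exact_iff_function_exact _).mp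
        (Ext.covariant_sequence_exact₃' N hS n (n + 1) rfl))
      ((ShortComplex.ab_exact_iff_function_exact _).mp
        (Ext.covariant_sequence_exact₃' K (hS.map F) n (n + 1) rfl))
      (hn _).surjective (hn _)
      (fun x₁ ↦ Ext.covariant_sequence_exact₁ _ hS x₁ (by subsingleton) rfl)
      (fun y₁ ↦ Ext.covariant_sequence_exact₁ _ (hS.map F) y₁ (by subsingleton) rfl)
    · ext e
      refine Eq.trans ?_ (extComparison_comp F η e (Ext.mk₀ S.g) (add_zero n)).symm
      rw [Ext.mapExactFunctor_mk₀]
      rfl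
    · ext e
      refine Eq.trans ?_ (extComparison_comp F η e hS.extClass rfl).symm
      rw [Ext.mapExactFunctor_extClass]
      rfl

end ExactFunctor

section RestrictScalars

variable {A B : Type u} [Ring A] [Ring B] (δ : B →+* A)

instance : Limits.PreservesFiniteLimits (ModuleCat.restrictScalars.{u} δ) := by
  have := ((ModuleCat.restrictScalars.{u} δ).exact_tfae.out 1 3).mp fun S h => by
    rw [CategoryTheory.ShortComplex.ShortExact.moduleCat_exact_iff_function_exact] at h ⊢
    exact h
  exact this.1

/-- Baer's criterion for a restricted module. The hypotheses say that `A` is free as a right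
`B`-module on the family `s`, with coordinates `c`. A map out of a left ideal `J` of `B` is then
extended coordinatewise to the left ideal of `A` generated by `δ '' J`. -/
theorem baer_restrictScalars {I : Type*} (s : I → A) (c : A →+ (I →₀ B))
    (hc : ∀ a b i, c (a * δ b) i = c a i * b)
    (hs : ∀ a, (c a).sum (fun i b => s i * δ b) = a)
    {M : Type u} [AddCommGroup M] [Module A M] (hM : Module.Baer A M) :
    letI := Module.compHom M δ
    Module.Baer B M := by
  let := Module.compHom M δ
  have smul_eq (b : B) (m : M) : b • m = δ b • m := rfl
  intro J f
  classical
  -- the extension of `f` by zero to a map of sets on all of `B`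
  let f' : B → M := fun b => if h : b ∈ J then f ⟨b, h⟩ else 0
  have f'_of {b : B} (h : b ∈ J) : f' b = f ⟨b, h⟩ := dif_pos h
  have f'_add {b b' : B} (h : b ∈ J) (h' : b' ∈ J) : f' (b + b') = f' b + f' b' := by
    rw [f'_of h, f'_of h', f'_of (J.add_mem h h'), ← map_add]; rfl
  have f'_mul (b : B) {j : B} (h : j ∈ J) : f' (b * j) = δ b • f' j := by
    rw [f'_of h, f'_of (J.mul_mem_left b h), ← smul_eq, ← map_smul]; rfl
  have f'_zero : f' 0 = 0 := by
    rw [f'_of J.zero_mem]; exact map_zero f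
  let L : Ideal A := Ideal.span (δ '' J)
  have mem_coord {a : A} (ha : a ∈ L) (i : I) : c a i ∈ J := by
    refine Submodule.span_induction (p := fun a _ => ∀ x, c (x * a) i ∈ J) ?_ ?_ ?_ ?_ ha 1 |>
      fun h => by simpa using h
    · rintro _ ⟨j, hj, rfl⟩ x
      rw [hc]; exact J.mul_mem_left _ hj
    · intro x; simp
    · intro a b _ _ h h' x
      rw [mul_add, map_add]; exact J.add_mem (h x) (h' x)
    · intro y a _ h x
      rw [smul_eq_mul, ← mul_assoc]; exact h _
  let G : A → M := fun a => (c a).sum fun i b => s i • f' b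
  have G_add {a a' : A} (ha : a ∈ L) (ha' : a' ∈ L) : G (a + a') = G a + G a' := by
    simp only [G, map_add]
    have h0 : ∀ i ∈ (c a).support ∪ (c a').support, s i • f' 0 = 0 := by simp [f'_zero]
    have hsub : (c a + c a').support ⊆ (c a).support ∪ (c a').support := Finsupp.support_add
    rw [Finsupp.sum_of_support_subset _ hsub _ h0,
      Finsupp.sum_of_support_subset (c a) Finset.subset_union_left _ h0,
      Finsupp.sum_of_support_subset (c a') Finset.subset_union_right _ h0,
      ← Finset.sum_add_distrib]
    refine Finset.sum_congr rfl fun i _ => ?_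
    rw [Finsupp.add_apply, f'_add (mem_coord ha i) (mem_coord ha' i), smul_add]
  have G_mul (a : A) {j : B} (hj : j ∈ J) : G (a * δ j) = a • f' j := by
    have h0 : ∀ i ∈ (c a).support, s i • f' 0 = 0 := by simp [f'_zero]
    have hsub : (c (a * δ j)).support ⊆ (c a).support := by
      intro i hi
      rw [Finsupp.mem_support_iff] at hi ⊢
      intro h
      exact hi (by rw [hc, h, zero_mul])
    simp only [G]
    rw [Finsupp.sum_of_support_subset _ hsub _ h0]
    conv_rhs => rw [← hs a, Finsupp.sum, Finset.sum_smul]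
    refine Finset.sum_congr rfl fun i _ => ?_
    rw [hc, f'_mul _ hj, smul_smul]
  have G_smul {a : A} (ha : a ∈ L) : ∀ x : A, G (x * a) = x • G a := by
    refine Submodule.span_induction (p := fun a _ => ∀ x, G (x * a) = x • G a) ?_ ?_ ?_ ?_ ha
    · rintro _ ⟨j, hj, rfl⟩ x
      have := G_mul 1 hj
      rw [one_mul] at this
      rw [G_mul x hj, this, one_smul]
    · intro x; simp [G]
    · intro a b ha hb h h' x
      rw [mul_add, G_add (L.mul_mem_left x ha) (L.mul_mem_left x hb), h, h', G_add ha hb, smul_add]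
    · intro y a _ h x
      rw [smul_eq_mul, ← mul_assoc, h, h, smul_smul]
  let g : L →ₗ[A] M :=
    { toFun := fun a => G a
      map_add' := fun a b => G_add a.2 b.2
      map_smul' := fun x a => G_smul a.2 x }
  obtain ⟨g', hg'⟩ := hM L g
  refine ⟨(LinearMap.toSpanSingleton B M (g' 1)), fun j hj => ?_⟩
  have hjL : δ j ∈ L := Ideal.subset_span ⟨j, hj, rfl⟩
  have h1 : g' (δ j) = G (δ j) := hg' _ hjL
  have h2 := G_mul 1 hj
  rw [one_mul, one_smul] at h2
  rw [LinearMap.toSpanSingleton_apply, smul_eq, ← map_smul, smul_eq_mul, mul_one, h1, h2, f'_of hj]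

/-- Restriction of scalars along `δ : B → A` preserves injectives if `A` is free as a right
`B`-module. -/
theorem preservesInjectiveObjects_restrictScalars {I : Type*} (s : I → A) (c : A →+ (I →₀ B))
    (hc : ∀ a b i, c (a * δ b) i = c a i * b)
    (hs : ∀ a, (c a).sum (fun i b => s i * δ b) = a) :
    (ModuleCat.restrictScalars.{u} δ).PreservesInjectiveObjects where
  injective_obj {M} hM := by
    have h1 : Module.Injective A M :=
      Module.injective_module_of_injective_object (inj := hM) A M
    let := Module.compHom M δ
    have h2 := (baer_restrictScalars δ s c hc hs (Module.Baer.of_injective h1)).injective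
    exact Module.injective_object_of_injective_module (inj := h2) B M

end RestrictScalars

/-! ### `Ext` and direct sums -/

section DirectSum

universe w v u₁

variable {C : Type u₁} [Category.{v} C] [Abelian C] [HasExt.{w} C]
  {I : Type*} {Y W : C} (f : I → (Y ⟶ W))

/-- The map `⨁ᵢ Ext X Y n → Ext X W n` induced by a family of morphisms `f i : Y ⟶ W`. -/
def extSum (X : C) (n : ℕ) : (I →₀ Ext.{w} X Y n) →+ Ext.{w} X W n :=
  Finsupp.liftAddHom fun i => (Ext.mk₀ (f i)).postcomp X (add_zero n)

theorem extSum_single (X : C) (n : ℕ) (i : I) (e : Ext.{w} X Y n) :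
    extSum f X n (Finsupp.single i e) = e.comp (Ext.mk₀ (f i)) (add_zero n) := by
  simp [extSum]

theorem extSum_precomp {X X' : C} {m n p : ℕ} (x : Ext.{w} X X' m) (h : m + n = p)
    (e : I →₀ Ext.{w} X' Y n) :
    extSum f X p (Finsupp.mapRange.addMonoidHom (x.precomp Y h) e) =
      x.comp (extSum f X' n e) h := by
  induction e using Finsupp.induction_linear with
  | zero => simp
  | add a b ha hb => rw [map_add, map_add, ha, hb, map_add, Ext.comp_add]
  | single i e =>
    rw [Finsupp.mapRange.addMonoidHom_apply, Finsupp.mapRange_single, extSum_single, extSum_single]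
    exact Ext.comp_assoc _ _ _ h (add_zero n) (by omega)

theorem exact_mapRange {M₁ M₂ M₃ : Type*} [AddCommGroup M₁] [AddCommGroup M₂] [AddCommGroup M₃]
    {f : M₁ →+ M₂} {g : M₂ →+ M₃} (h : Function.Exact f g) (I : Type*) :
    Function.Exact (Finsupp.mapRange.addMonoidHom (ι := I) f)
      (Finsupp.mapRange.addMonoidHom (ι := I) g) := by
  classical
  intro y
  constructor
  · intro hy
    have hy' (i : I) : g (y i) = 0 := DFunLike.congr_fun hy i
    choose s hs using fun i => (h (y i)).1 (hy' i)
    refine ⟨Finsupp.onFinset y.support (fun i => if i ∈ y.support then s i else 0) ?_, ?_⟩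
    · intro i hi
      by_contra h'
      simp [h'] at hi
    · ext i
      by_cases hi : i ∈ y.support
      · have := hs i
        simp_all
      · simp only [Finsupp.mapRange.addMonoidHom_apply, Finsupp.mapRange_apply,
          Finsupp.onFinset_apply, if_neg hi, map_zero]
        exact (Finsupp.notMem_support_iff.1 hi).symm
  · rintro ⟨x, rfl⟩
    ext i
    exact h.apply_apply_eq_zero (x i)

/-- Dimension shifting for the comparison of `Ext` with direct sums. -/
theorem extSum_bijective_succ {S : ShortComplex C} (hS : S.ShortExact) [Projective S.X₂] {n : ℕ}
    (h₂ : Function.Surjective (extSum f S.X₂ n)) (h₁ : Function.Bijective (extSum f S.X₁ n)) :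
    Function.Bijective (extSum f S.X₃ (n + 1)) := by
  refine AddMonoidHom.bijective_of_surjective_of_bijective_of_right_exact
    (Finsupp.mapRange.addMonoidHom ((Ext.mk₀ S.f).precomp Y (zero_add n)))
    (Finsupp.mapRange.addMonoidHom (hS.extClass.precomp Y (add_comm 1 n)))
    ((Ext.mk₀ S.f).precomp W (zero_add n)) (hS.extClass.precomp W (add_comm 1 n))
    (extSum f S.X₂ n) (extSum f S.X₁ n) (extSum f S.X₃ (n + 1)) ?_ ?_
    (exact_mapRange ((ShortComplex.ab_exact_iff_function_exact _).1
      (Ext.contravariant_sequence_exact₁' hS Y n (n + 1) (add_comm 1 n))) I)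
    ((ShortComplex.ab_exact_iff_function_exact _).1
      (Ext.contravariant_sequence_exact₁' hS W n (n + 1) (add_comm 1 n))) h₂ h₁ ?_
    (fun y => Ext.contravariant_sequence_exact₃ hS _ y (Ext.eq_zero_of_projective _)
      (add_comm 1 n))
  · exact AddMonoidHom.ext fun e => (extSum_precomp f _ _ e).symm
  · exact AddMonoidHom.ext fun e => (extSum_precomp f _ _ e).symm
  · rw [Finsupp.mapRange.addMonoidHom]
    exact Finsupp.mapRange_surjective _ (map_zero _) fun y =>
      Ext.contravariant_sequence_exact₃ hS _ y (Ext.eq_zero_of_projective _) (add_comm 1 n)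

end DirectSum

section Noetherian

variable {B : Type u} [Ring B] {W : Type u} [AddCommGroup W] [Module B W]

/-- The morphism `b ↦ b • w` from the regular module. -/
def spanHom (B : Type u) [Ring B] {W : Type u} [AddCommGroup W] [Module B W] (w : W) :
    ModuleCat.of B B ⟶ ModuleCat.of B W :=
  ModuleCat.ofHom (LinearMap.toSpanSingleton B W w)

theorem extSum_zero_bijective {I : Type u} (β : Module.Basis I B W) (K : Type u) [AddCommGroup K]
    [Module B K] [Module.Finite B K] :
    Function.Bijective (extSum.{u} (fun i => spanHom B (β i)) (ModuleCat.of B K) 0) := by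
  classical
  let c (i : I) : ModuleCat.of B W ⟶ ModuleCat.of B B := ModuleCat.ofHom (β.coord i)
  have hc (i j : I) : spanHom B (β i) ≫ c j = if i = j then 𝟙 _ else 0 := by
    split_ifs with h
    · subst h; ext; simp [spanHom, c]
    · ext; simp [spanHom, c, h]
  have hcoord (j : I) (e : I →₀ Ext.{u} (ModuleCat.of B K) (ModuleCat.of B B) 0) :
      (extSum (fun i => spanHom B (β i)) (ModuleCat.of B K) 0 e).comp
        (Ext.mk₀ (c j)) (add_zero 0) = e j := by
    induction e using Finsupp.induction_linear with
    | zero => simp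
    | add a b ha hb => rw [map_add, Ext.add_comp, ha, hb, Finsupp.add_apply]
    | single i e =>
      rw [extSum_single, Ext.comp_assoc _ _ _ (add_zero 0) (add_zero 0) (by omega),
        Ext.mk₀_comp_mk₀, hc]
      split_ifs with h
      · subst h; simp
      · simp [h]
  constructor
  · intro e e' h
    ext j
    rw [← hcoord j e, h, hcoord]
  · intro e
    obtain ⟨g, rfl⟩ := (Ext.mk₀_bijective _ _).2 e
    obtain ⟨s, hs⟩ := (Module.Finite.fg_top : (⊤ : Submodule B K).FG)
    -- a map out of a finitely generated module involves only finitely many coordinates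
    let T : Finset I := s.biUnion fun x => (β.repr (g.hom x)).support
    have hT (x : K) (i : I) (hi : i ∉ T) : β.repr (g.hom x) i = 0 := by
      have : x ∈ LinearMap.ker ((β.coord i).comp g.hom) := by
        have hle : (⊤ : Submodule B K) ≤ LinearMap.ker ((β.coord i).comp g.hom) := by
          rw [← hs, Submodule.span_le]
          intro y hy
          by_contra h
          exact hi (Finset.mem_biUnion.2 ⟨y, hy, Finsupp.mem_support_iff.2 h⟩)
        exact hle trivial
      exact this
    refine ⟨∑ i ∈ T, Finsupp.single i (Ext.mk₀ (g ≫ c i)), ?_⟩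
    rw [map_sum]
    simp only [extSum_single, Ext.mk₀_comp_mk₀]
    refine (map_sum Ext.addEquiv₀.symm (fun i => (g ≫ c i) ≫ spanHom B (β i)) T).symm.trans ?_
    rw [Ext.addEquiv₀_symm_apply]
    congr 1
    ext x
    have h1 : g.hom x = ∑ i ∈ T, β.repr (g.hom x) i • β i := by
      conv_lhs => rw [← β.linearCombination_repr (g.hom x)]
      rw [Finsupp.linearCombination_apply]
      exact Finsupp.sum_of_support_subset _
        (fun i hi => by_contra fun h => Finsupp.mem_support_iff.1 hi (hT x i h)) _ (by simp)
    refine Eq.trans ?_ h1.symm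
    simp [spanHom, c]

/-- Over a left noetherian ring `Ext` out of a finitely generated module commutes with direct
sums; here for a free module `W` with basis `β`. -/
theorem extSum_bijective [IsNoetherianRing B] {I : Type u} (β : Module.Basis I B W) (K : Type u)
    [AddCommGroup K] [Module B K] [Module.Finite B K] (n : ℕ) :
    Function.Bijective (extSum.{u} (fun i => spanHom B (β i)) (ModuleCat.of B K) n) := by
  induction n generalizing K with
  | zero => exact extSum_zero_bijective β K
  | succ n ih =>
    obtain ⟨r, g, hg⟩ := Module.Finite.exists_fin' B K
    have : Projective g.shortComplexKer.X₂ :=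
      inferInstanceAs (Projective (ModuleCat.of B (Fin r → B)))
    exact extSum_bijective_succ _ (LinearMap.shortExact_shortComplexKer hg) (ih _).2 (ih _)

end Noetherian

/-! ### Extensions of algebras that are free on both sides -/

section Character

variable {k B : Type u} [Field k] [Ring B] [Algebra k B]

theorem rightMul_mul (a b : B) : rightMul (a * b) = rightMul a ≫ rightMul b := by
  ext; simp [rightMul]

theorem rightMul_add (a b : B) : rightMul (a + b) = rightMul a + rightMul b := by
  ext; simp [rightMul]

/-- If `Ext K B n` is one-dimensional, then the right action of `B` on it is given by a
character. -/
theorem exists_character (K : ModuleCat.{u} B) (n : ℕ)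
    (h : Module.finrank k (Ext.{u} K (ModuleCat.of B B) n) = 1) :
    ∃ χ : B →ₐ[k] k, ∀ (e : Ext.{u} K (ModuleCat.of B B) n) (b : B),
      e.comp (Ext.mk₀ (rightMul b)) (add_zero n) = χ b • e := by
  obtain ⟨e, he, hspan⟩ := finrank_eq_one_iff'.1 h
  choose χ hχ using fun b : B => hspan (e.comp (Ext.mk₀ (rightMul b)) (add_zero n))
  have inj {c c' : k} (h : c • e = c' • e) : c = c' := smul_left_injective k he h
  have hall (e' : Ext.{u} K (ModuleCat.of B B) n) (b : B) :
      e'.comp (Ext.mk₀ (rightMul b)) (add_zero n) = χ b • e' := by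
    obtain ⟨c, rfl⟩ := hspan e'
    rw [Ext.smul_comp, ← hχ, smul_comm]
  have map_add (a b : B) : χ (a + b) = χ a + χ b := by
    apply inj
    rw [hχ, rightMul_add, Ext.mk₀_add, Ext.comp_add, ← hχ, ← hχ, add_smul]
  have map_mul (a b : B) : χ (a * b) = χ a * χ b := by
    apply inj
    rw [hχ, rightMul_mul, ← Ext.mk₀_comp_mk₀,
      ← Ext.comp_assoc _ _ _ (add_zero n) (add_zero 0) (by omega), hall e a, Ext.smul_comp, ← hχ,
      smul_smul]
  have map_algebraMap (c : k) : χ (algebraMap k B c) = c := by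
    apply inj
    rw [hχ, Ext.smul_eq_comp_mk₀]
    congr 2
    apply ModuleCat.hom_ext
    ext
    change 1 * algebraMap k B c = algebraMap k B c * 1
    rw [one_mul, mul_one]
  exact ⟨{
    toFun := χ
    map_one' := by simpa using map_algebraMap 1
    map_mul' := map_mul
    map_zero' := by simpa using map_algebraMap 0
    map_add' := map_add
    commutes' := map_algebraMap }, hall⟩

end Character

section FreeExtension

variable {k A B V : Type u} [Field k] [Ring A] [Algebra k A] [Ring B] [Algebra k B]
  [AddCommGroup V] [Module k V] (δ : B →ₐ[k] A) (t : V →ₗ[k] A)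

/-- The map `b ⊗ v ↦ δ b * t v`. It is bijective when `A` is free as a left `B`-module on the
`t`-image of a basis of `V`. -/
def leftSpan : B ⊗[k] V →ₗ[k] A :=
  TensorProduct.lift ((LinearMap.mul k A).compl₁₂ δ.toLinearMap t)

/-- The map `b ⊗ v ↦ t v * δ b`. It is bijective when `A` is free as a right `B`-module on the
`t`-image of a basis of `V`. -/
def rightSpan : B ⊗[k] V →ₗ[k] A :=
  TensorProduct.lift ((LinearMap.mul k A).flip.compl₁₂ δ.toLinearMap t)

@[simp] theorem leftSpan_tmul (b : B) (v : V) : leftSpan δ t (b ⊗ₜ v) = δ b * t v := rfl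

@[simp] theorem rightSpan_tmul (b : B) (v : V) : rightSpan δ t (b ⊗ₜ v) = t v * δ b := rfl

/-- Bijectivity of `rightSpan` makes `A` a free right `B`-module, so restriction along `δ` preserves
injectives. -/
theorem preservesInjectiveObjects_of_rightSpan (hr : Function.Bijective (rightSpan δ t)) :
    (ModuleCat.restrictScalars.{u} δ.toRingHom).PreservesInjectiveObjects := by
  let R := LinearEquiv.ofBijective _ hr
  have hR (z) : R z = rightSpan δ t z := rfl
  let b := Module.Basis.ofVectorSpace k V
  let β := Algebra.TensorProduct.basis B b
  refine preservesInjectiveObjects_restrictScalars _ (fun i => t (b i))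
    ((β.repr.toLinearMap.toAddMonoidHom).comp R.symm.toLinearMap.toAddMonoidHom) ?_ ?_
  · intro a y i
    obtain ⟨z, rfl⟩ := R.surjective a
    induction z with
    | zero => simp
    | add z z' hz hz' => simp_all [add_mul]
    | tmul x v =>
      have h : R (x ⊗ₜ v) * δ.toRingHom y = R ((x * y) ⊗ₜ v) := by
        simp [hR, mul_assoc]
      rw [h]
      simp [β, Algebra.TensorProduct.basis_repr_tmul, mul_assoc,
        Algebra.commutes (b.repr v i) y]
  · intro a
    obtain ⟨z, rfl⟩ := R.surjective a
    conv_rhs => rw [← β.linearCombination_repr z, Finsupp.linearCombination_apply, map_finsuppSum]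
    change (β.repr (R.symm (R z))).sum _ = _
    rw [R.symm_apply_apply]
    simp [β, hR, TensorProduct.smul_tmul']

variable {K : ModuleCat.{u} B} {n : ℕ} (e : Ext.{u} K (ModuleCat.of B B) n)

/-- The morphism `b ↦ δ b * a` of left `B`-modules. -/
def spanRestrict (a : A) :
    ModuleCat.of B B ⟶
      (ModuleCat.restrictScalars.{u} δ.toRingHom).obj (ModuleCat.of A A) :=
  letI := Module.compHom A δ.toRingHom
  spanHom B a

/-- The additive map sending `a` to the image of `e` under `b ↦ δ b * a`. -/
def pushExt : A →+ Ext.{u} K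
    ((ModuleCat.restrictScalars.{u} δ.toRingHom).obj (ModuleCat.of A A)) n where
  toFun a := e.comp (Ext.mk₀ (spanRestrict δ a)) (add_zero n)
  map_zero' := by
    have h : spanRestrict δ (0 : A) = 0 := by
      apply ModuleCat.hom_ext
      ext
      exact mul_zero (δ 1)
    rw [h, Ext.mk₀_zero, Ext.comp_zero]
  map_add' a a' := by
    have h : spanRestrict δ (a + a') = spanRestrict δ a + spanRestrict δ a' := by
      apply ModuleCat.hom_ext
      ext
      exact mul_add (δ 1) a a'
    rw [h, Ext.mk₀_add, Ext.comp_add]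

theorem pushExt_apply (a : A) :
    pushExt δ e a = e.comp (Ext.mk₀ (spanRestrict δ a)) (add_zero n) := rfl

theorem pushExt_mul_left (b : B) (a : A) :
    pushExt δ e (δ b * a) = pushExt δ (e.comp (Ext.mk₀ (rightMul b)) (add_zero n)) a := by
  have h : spanRestrict δ (δ b * a) = rightMul b ≫ spanRestrict δ a := by
    apply ModuleCat.hom_ext
    ext
    change δ 1 * (δ b * a) = δ (1 * b) * a
    rw [map_one, one_mul, one_mul]
  rw [pushExt_apply, pushExt_apply, h, ← Ext.mk₀_comp_mk₀]
  exact (Ext.comp_assoc _ _ _ (add_zero n) (add_zero 0) (by omega)).symm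

theorem pushExt_mul_right (a c : A) :
    pushExt δ e (a * c) = (pushExt δ e a).comp
      (Ext.mk₀ ((ModuleCat.restrictScalars.{u} δ.toRingHom).map (rightMul c))) (add_zero n) := by
  have h : spanRestrict δ (a * c) = spanRestrict δ a ≫
      (ModuleCat.restrictScalars.{u} δ.toRingHom).map (rightMul c) := by
    apply ModuleCat.hom_ext
    ext
    change δ 1 * (a * c) = (δ 1 * a) * c
    rw [mul_assoc]
  rw [pushExt_apply, pushExt_apply, h, ← Ext.mk₀_comp_mk₀]
  exact (Ext.comp_assoc _ _ _ (add_zero n) (add_zero 0) (by omega)).symm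

variable {e} {χ : B →ₐ[k] k}

theorem pushExt_smul (hχ : ∀ b, e.comp (Ext.mk₀ (rightMul b)) (add_zero n) = χ b • e) (c : k)
    (a : A) : pushExt δ e (c • a) = pushExt δ (c • e) a := by
  have h : c • a = δ (algebraMap k B c) * a := by
    rw [AlgHom.commutes, Algebra.smul_def]
  rw [h, pushExt_mul_left, hχ, AlgHom.commutes, Algebra.algebraMap_self_apply]

/-- Elements of `B` standing to the left of `t` are absorbed by `e` through the character `χ`. -/
theorem pushExt_leftSpan (hχ : ∀ b, e.comp (Ext.mk₀ (rightMul b)) (add_zero n) = χ b • e)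
    (z : B ⊗[k] V) :
    pushExt δ e (leftSpan δ t z) =
      pushExt δ e (t (TensorProduct.lid k V (χ.toLinearMap.rTensor V z))) := by
  induction z with
  | zero => simp
  | add z z' hz hz' => simp only [map_add, hz, hz']
  | tmul b v =>
    rw [leftSpan_tmul, pushExt_mul_left, hχ, ← pushExt_smul δ hχ]
    simp

/-- If `Ext K B n` is the line spanned by `e` and `A` is free over `B` on `V`, then `Ext K A n`
is a copy of `V`. -/
theorem pushExt_bijective [IsNoetherianRing B] [Module.Finite B K]
    (hl : Function.Bijective (leftSpan δ t))
    (hχ : ∀ b, e.comp (Ext.mk₀ (rightMul b)) (add_zero n) = χ b • e)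
    (he : Function.Bijective fun c : k => c • e) :
    Function.Bijective fun v : V => pushExt δ e (t v) := by
  let := Module.compHom A δ.toRingHom
  let L : B ⊗[k] V ≃ₗ[B] A :=
    { LinearEquiv.ofBijective _ hl with
      map_smul' := fun b z => by
        change leftSpan δ t (b • z) = δ b * leftSpan δ t z
        induction z with
        | zero => simp
        | add z z' hz hz' => simp only [smul_add, map_add, mul_add, hz, hz']
        | tmul x v => simp [TensorProduct.smul_tmul', mul_assoc] }
  let b := Module.Basis.ofVectorSpace k V
  let β : Module.Basis _ B A := (Algebra.TensorProduct.basis B b).map L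
  have hβ (i) : β i = t (b i) := by
    change leftSpan δ t _ = _
    simp
  let E : k →+ Ext.{u} K (ModuleCat.of B B) n :=
    { toFun := fun c => c • e
      map_zero' := zero_smul _ _
      map_add' := fun c c' => add_smul c c' e }
  have hE : Function.Bijective E := he
  have h (v : V) : pushExt δ e (t v) = extSum.{u} (fun i => spanHom B (β i)) K n
      (Finsupp.mapRange.addMonoidHom E (b.repr v)) := by
    obtain ⟨w, rfl⟩ := b.repr.symm.surjective v
    rw [LinearEquiv.apply_symm_apply]
    induction w using Finsupp.induction_linear with
    | zero =>
      rw [map_zero, map_zero, map_zero, map_zero]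
      exact (map_zero _).symm
    | add w w' hw hw' =>
      rw [map_add, map_add, map_add, hw, hw', map_add]
      exact (map_add _ _ _).symm
    | single i c =>
      rw [Finsupp.mapRange.addMonoidHom_apply, Finsupp.mapRange_single, extSum_single,
        Module.Basis.repr_symm_single, map_smul, pushExt_smul δ hχ, hβ]
      rfl
  have h' : (fun v : V => pushExt δ e (t v)) = extSum.{u} (fun i => spanHom B (β i)) K n ∘
      Finsupp.mapRange.addMonoidHom E ∘ b.repr := funext h
  rw [h']
  refine (extSum_bijective β K n).comp (Function.Bijective.comp ?_ b.repr.bijective)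
  exact ⟨Finsupp.mapRange_injective _ (map_zero E) hE.1,
    Finsupp.mapRange_surjective _ (map_zero E) hE.2⟩

/-- Let `A` be free over `B`, on the left and on the right, on `t : V → A`, and let the
`A`-module `N` corepresent `Hom K` of restricted modules. If `Ext K B n` is the line spanned by
`e`, with right action given by `χ`, then `Ext N A n` is a copy of `V`, and its right `A`-action is
computed by moving the elements of `B` to the left of `t` and applying `χ` to them. -/
theorem exists_ext_equiv [IsNoetherianRing B] [Module.Finite B K]
    (hl : Function.Bijective (leftSpan δ t)) (hr : Function.Bijective (rightSpan δ t))
    (hχ : ∀ b, e.comp (Ext.mk₀ (rightMul b)) (add_zero n) = χ b • e)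
    (he : Function.Bijective fun c : k => c • e) {N : ModuleCat.{u} A}
    (η : K ⟶ (ModuleCat.restrictScalars.{u} δ.toRingHom).obj N)
    (hη : ∀ M : ModuleCat.{u} A, Function.Bijective fun f : N ⟶ M =>
      η ≫ (ModuleCat.restrictScalars.{u} δ.toRingHom).map f) :
    ∃ J : V ≃+ Ext.{u} N (ModuleCat.of A A) n, ∀ (v : V) (c : A) (z : B ⊗[k] V),
      t v * c = leftSpan δ t z →
        (J v).comp (Ext.mk₀ (rightMul c)) (add_zero n) =
          J (TensorProduct.lid k V (χ.toLinearMap.rTensor V z)) := by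
  have := preservesInjectiveObjects_of_rightSpan δ t hr
  let Φ := AddEquiv.ofBijective _ (extComparison_bijective
    (ModuleCat.restrictScalars.{u} δ.toRingHom) η hη (ModuleCat.of A A) n)
  let J' : V ≃+ _ := AddEquiv.ofBijective ((pushExt δ e).comp t.toAddMonoidHom)
    (pushExt_bijective δ t hl hχ he)
  have hJ' (v) : J' v = pushExt δ e (t v) := rfl
  have hΦ (x) : Φ x = extComparison _ η _ n x := rfl
  refine ⟨J'.trans Φ.symm, fun v c z h => ?_⟩
  apply Φ.injective
  rw [AddEquiv.trans_apply, AddEquiv.trans_apply, AddEquiv.apply_symm_apply, hΦ,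
    extComparison_comp, ← hΦ, AddEquiv.apply_symm_apply, Ext.mapExactFunctor_mk₀, hJ', hJ',
    ← pushExt_mul_right, h, pushExt_leftSpan δ t hχ]

end FreeExtension

/-! ### The enveloping algebra of a Hopf algebra -/

section Twist

variable {k C V : Type u} [Field k] [AddCommGroup C] [Module k C] [Coalgebra k C]
  [AddCommGroup V] [Module k V]

/-- The map `x ⊗ v ↦ x₁ ⊗ s(x₂) v`. -/
def twistRight (s : WithConv (C →ₗ[k] Module.End k V)) : C ⊗[k] V →ₗ[k] C ⊗[k] V :=
  (TensorProduct.lift s.ofConv).lTensor C ∘ₗ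
    (TensorProduct.assoc k C C V).toLinearMap ∘ₗ (comul (R := k)).rTensor V

/-- The map `v ⊗ y ↦ s(y₁) v ⊗ y₂`. The opposite of the endomorphism ring makes it
multiplicative in `s` up to order. -/
def twistLeft (s : WithConv (C →ₗ[k] (Module.End k V)ᵐᵒᵖ)) : V ⊗[k] C →ₗ[k] V ⊗[k] C :=
  (TensorProduct.lift
      ((MulOpposite.opLinearEquiv k).symm.toLinearMap ∘ₗ s.ofConv).flip).rTensor C ∘ₗ
    (TensorProduct.assoc k V C C).symm.toLinearMap ∘ₗ (comul (R := k)).lTensor V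

theorem twistRight_tmul (s : WithConv (C →ₗ[k] Module.End k V)) {ι : Type*} {x : C}
    (r : Repr k x ι) (v : V) :
    twistRight s (x ⊗ₜ v) = ∑ i ∈ r.index, r.left i ⊗ₜ s.ofConv (r.right i) v := by
  simp [twistRight, ← r.eq, TensorProduct.sum_tmul]

theorem twistLeft_tmul (s : WithConv (C →ₗ[k] (Module.End k V)ᵐᵒᵖ)) {ι : Type*} {y : C}
    (r : Repr k y ι) (v : V) :
    twistLeft s (v ⊗ₜ y) =
      ∑ i ∈ r.index, (s.ofConv (r.left i)).unop v ⊗ₜ[k] r.right i := by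
  simp [twistLeft, ← r.eq, TensorProduct.tmul_sum]

/-- Coassociativity turns convolution into composition. -/
theorem twistRight_mul (s t : WithConv (C →ₗ[k] Module.End k V)) :
    twistRight (s * t) = twistRight s ∘ₗ twistRight t := by
  ext x v
  let r := Repr.arbitrary k x
  let f : C ⊗[k] (C ⊗[k] C) →ₗ[k] C ⊗[k] V :=
    (LinearMap.applyₗ v ∘ₗ TensorProduct.lift
      ((LinearMap.mul k (Module.End k V)).compl₁₂ s.ofConv t.ofConv)).lTensor C
  have h := congrArg f (sum_tmul_tmul_eq r (fun i => Repr.arbitrary k (r.left i))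
    fun i => Repr.arbitrary k (r.right i))
  simp only [map_sum, f, LinearMap.lTensor_tmul] at h
  simp only [TensorProduct.AlgebraTensorModule.curry_apply, LinearMap.restrictScalars_self,
    TensorProduct.curry_apply, LinearMap.comp_apply, twistRight_tmul _ r, map_sum,
    fun i => (Repr.arbitrary k (r.right i)).convMul_apply s t,
    fun i => twistRight_tmul s (Repr.arbitrary k (r.left i)),
    LinearMap.sum_apply, TensorProduct.tmul_sum]
  exact h.symm

theorem twistLeft_mul (s t : WithConv (C →ₗ[k] (Module.End k V)ᵐᵒᵖ)) :
    twistLeft (s * t) = twistLeft t ∘ₗ twistLeft s := by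
  ext v x
  let r := Repr.arbitrary k x
  let f : C ⊗[k] (C ⊗[k] C) →ₗ[k] V ⊗[k] C :=
    (LinearMap.applyₗ v ∘ₗ (MulOpposite.opLinearEquiv k).symm.toLinearMap ∘ₗ TensorProduct.lift
      ((LinearMap.mul k (Module.End k V)ᵐᵒᵖ).compl₁₂ s.ofConv t.ofConv)).rTensor C ∘ₗ
      (TensorProduct.assoc k C C C).symm.toLinearMap
  have h := congrArg f (sum_tmul_tmul_eq r (fun i => Repr.arbitrary k (r.left i))
    fun i => Repr.arbitrary k (r.right i))
  simp only [map_sum, f, LinearMap.comp_apply, LinearEquiv.coe_coe,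
    TensorProduct.assoc_symm_tmul, LinearMap.rTensor_tmul] at h
  simp only [TensorProduct.AlgebraTensorModule.curry_apply, LinearMap.restrictScalars_self,
    TensorProduct.curry_apply, LinearMap.comp_apply, twistLeft_tmul _ r, map_sum,
    fun i => (Repr.arbitrary k (r.left i)).convMul_apply s t,
    fun i => twistLeft_tmul t (Repr.arbitrary k (r.right i)),
    Finset.unop_sum, LinearMap.sum_apply, TensorProduct.sum_tmul]
  exact h

theorem twistRight_one : twistRight (1 : WithConv (C →ₗ[k] Module.End k V)) = LinearMap.id := by
  ext x v
  let r := Repr.arbitrary k x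
  have h := congrArg (fun z => TensorProduct.map LinearMap.id
    (LinearMap.toSpanSingleton k V v) z) (sum_tmul_counit_eq r)
  simp only [map_sum, TensorProduct.map_tmul] at h
  simp only [TensorProduct.AlgebraTensorModule.curry_apply, LinearMap.restrictScalars_self,
    TensorProduct.curry_apply, twistRight_tmul _ r]
  simpa [LinearMap.convOne_def] using h

theorem twistLeft_one :
    twistLeft (1 : WithConv (C →ₗ[k] (Module.End k V)ᵐᵒᵖ)) = LinearMap.id := by
  ext v x
  let r := Repr.arbitrary k x
  have h := congrArg (fun z => TensorProduct.map
    (LinearMap.toSpanSingleton k V v) LinearMap.id z) (sum_counit_tmul_eq r)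
  simp only [map_sum, TensorProduct.map_tmul] at h
  simp only [TensorProduct.AlgebraTensorModule.curry_apply, LinearMap.restrictScalars_self,
    TensorProduct.curry_apply, twistLeft_tmul _ r]
  simpa [LinearMap.convOne_def] using h

theorem twistRight_bijective {s t : WithConv (C →ₗ[k] Module.End k V)} (hst : s * t = 1)
    (hts : t * s = 1) : Function.Bijective (twistRight s) :=
  Function.bijective_iff_has_inverse.2 ⟨twistRight t,
    fun x => by rw [← LinearMap.comp_apply, ← twistRight_mul, hts, twistRight_one]; rfl,
    fun x => by rw [← LinearMap.comp_apply, ← twistRight_mul, hst, twistRight_one]; rfl⟩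

theorem twistLeft_bijective {s t : WithConv (C →ₗ[k] (Module.End k V)ᵐᵒᵖ)} (hst : s * t = 1)
    (hts : t * s = 1) : Function.Bijective (twistLeft s) :=
  Function.bijective_iff_has_inverse.2 ⟨twistLeft t,
    fun x => by rw [← LinearMap.comp_apply, ← twistLeft_mul, hst, twistLeft_one]; rfl,
    fun x => by rw [← LinearMap.comp_apply, ← twistLeft_mul, hts, twistLeft_one]; rfl⟩

end Twist

section Antipode

variable {k H E : Type u} [Field k] [Ring H] [HopfAlgebra k H] [Ring E] [Algebra k E]

/-- An algebra homomorphism is convolution invertible, with inverse its composite with the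
antipode. -/
theorem conv_antipode_mul (f : H →ₐ[k] E) :
    WithConv.toConv (f.toLinearMap ∘ₗ antipode k) * WithConv.toConv f.toLinearMap = 1 := by
  have h := congrArg WithConv.toConv (LinearMap.algHom_comp_convMul_distrib f
    (WithConv.toConv (antipode k)) (WithConv.toConv (LinearMap.id : H →ₗ[k] H)))
  rw [LinearMap.antipode_mul_id] at h
  refine Eq.trans h.symm ?_
  ext a
  simp [LinearMap.convOne_def]

theorem conv_mul_antipode (f : H →ₐ[k] E) :
    WithConv.toConv f.toLinearMap * WithConv.toConv (f.toLinearMap ∘ₗ antipode k) = 1 := by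
  have h := congrArg WithConv.toConv (LinearMap.algHom_comp_convMul_distrib f
    (WithConv.toConv (LinearMap.id : H →ₗ[k] H)) (WithConv.toConv (antipode k)))
  rw [LinearMap.id_mul_antipode] at h
  refine Eq.trans h.symm ?_
  ext a
  simp [LinearMap.convOne_def]

variable (k H)

/-- `h ↦ (y ↦ h y)`. -/
def mulLeftHom : H →ₐ[k] Module.End k H := Algebra.lmul k H

/-- `h ↦ (y ↦ y h)`, with values in the opposite endomorphism ring. -/
def mulRightHom : H →ₐ[k] (Module.End k H)ᵐᵒᵖ :=
  AlgHom.ofLinearMap ((MulOpposite.opLinearEquiv k).toLinearMap ∘ₗ (LinearMap.mul k H).flip)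
    (by apply MulOpposite.unop_injective; ext; simp)
    (fun x y => by apply MulOpposite.unop_injective; ext; simp [mul_assoc])

/-- `h ↦ (y ↦ y S(h))`. -/
def mulRightAntipodeHom : H →ₐ[k] Module.End k H :=
  AlgHom.ofLinearMap ((LinearMap.mul k H).flip ∘ₗ antipode k) (by ext; simp)
    (fun x y => by ext; simp [mul_assoc, antipode_mul_antidistrib])

/-- `h ↦ (y ↦ S(h) y)`, with values in the opposite endomorphism ring. -/
def mulLeftAntipodeHom : H →ₐ[k] (Module.End k H)ᵐᵒᵖ :=
  AlgHom.ofLinearMap ((MulOpposite.opLinearEquiv k).toLinearMap ∘ₗ LinearMap.mul k H ∘ₗ antipode k)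
    (by apply MulOpposite.unop_injective; ext; simp)
    (fun x y => by
      apply MulOpposite.unop_injective; ext; simp [mul_assoc, antipode_mul_antidistrib])

/-- The algebra map `h ↦ h₁ ⊗ S(h₂)` into the enveloping algebra. Restriction along it turns
bimodules into left modules with the adjoint action `h · m = h₁ m S(h₂)`. -/
def leftAdjoint : H →ₐ[k] H ⊗[k] Hᵐᵒᵖ :=
  (Algebra.TensorProduct.map (AlgHom.id k H) (antipodeAlgHomOp k H)).comp
    (Bialgebra.comulAlgHom k H)

/-- The algebra map `h ↦ S(h₁) ⊗ h₂` into the enveloping algebra. Restriction along it turns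
bimodules into right modules with the adjoint action `m · h = S(h₁) m h₂`. -/
def rightAdjoint : Hᵐᵒᵖ →ₐ[k] H ⊗[k] Hᵐᵒᵖ :=
  AlgHom.ofLinearMap
    (TensorProduct.map (antipode k) (MulOpposite.opLinearEquiv k).toLinearMap ∘ₗ comul ∘ₗ
      (MulOpposite.opLinearEquiv k).symm.toLinearMap)
    (by simp [Algebra.TensorProduct.one_def])
    (fun x y => by
      have h (z w : H ⊗[k] H) :
          TensorProduct.map (antipode k) (MulOpposite.opLinearEquiv k).toLinearMap (z * w) =
            TensorProduct.map (antipode k) (MulOpposite.opLinearEquiv k).toLinearMap w *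
              TensorProduct.map (antipode k) (MulOpposite.opLinearEquiv k).toLinearMap z := by
        induction z with
        | zero => simp
        | add z z' hz hz' => simp only [add_mul, mul_add, map_add, hz, hz']
        | tmul a b =>
          induction w with
          | zero => simp
          | add w w' hw hw' => simp only [add_mul, mul_add, map_add, hw, hw']
          | tmul c d => simp [antipode_mul_antidistrib]
      simp [h])

/-- `y ↦ 1 ⊗ y`. -/
def inclRight : H →ₗ[k] H ⊗[k] Hᵐᵒᵖ :=
  TensorProduct.mk k H Hᵐᵒᵖ 1 ∘ₗ (MulOpposite.opLinearEquiv k).toLinearMap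

/-- `x ↦ x ⊗ 1`. -/
def inclLeft : H →ₗ[k] H ⊗[k] Hᵐᵒᵖ := (TensorProduct.mk k H Hᵐᵒᵖ).flip 1

variable {k H}

theorem inclRight_apply (y : H) : inclRight k H y = 1 ⊗ₜ MulOpposite.op y := rfl

theorem inclLeft_apply (x : H) : inclLeft k H x = x ⊗ₜ 1 := rfl

theorem leftAdjoint_apply {ι : Type*} {h : H} (r : Repr k h ι) :
    leftAdjoint k H h = ∑ i ∈ r.index, r.left i ⊗ₜ MulOpposite.op (antipode k (r.right i)) := by
  simp [leftAdjoint, ← r.eq]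

theorem rightAdjoint_apply {ι : Type*} {h : H} (r : Repr k h ι) :
    rightAdjoint k H (MulOpposite.op h) =
      ∑ i ∈ r.index, antipode k (r.left i) ⊗ₜ MulOpposite.op (r.right i) := by
  change TensorProduct.map (antipode k) (MulOpposite.opLinearEquiv k).toLinearMap (comul h) = _
  simp [← r.eq]

variable (k H) in
/-- The linear identification of `H ⊗ H` with the enveloping algebra. -/
def opRight : H ⊗[k] H ≃ₗ[k] H ⊗[k] Hᵐᵒᵖ :=
  TensorProduct.congr (LinearEquiv.refl k H) (MulOpposite.opLinearEquiv k)

variable (k H) in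
/-- The linear identification of `Hᵐᵒᵖ ⊗ H` with `H ⊗ H` exchanging the factors. -/
def unopSwap : Hᵐᵒᵖ ⊗[k] H ≃ₗ[k] H ⊗[k] H :=
  (TensorProduct.comm k Hᵐᵒᵖ H).trans
    (TensorProduct.congr (LinearEquiv.refl k H) (MulOpposite.opLinearEquiv k).symm)

theorem leftSpan_leftAdjoint (z : H ⊗[k] H) :
    leftSpan (leftAdjoint k H) (inclRight k H) z =
      opRight k H (twistRight (WithConv.toConv (mulRightAntipodeHom k H).toLinearMap) z) := by
  induction z with
  | zero => simp
  | add z z' hz hz' => simp only [map_add, hz, hz']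
  | tmul x y =>
    let r := Repr.arbitrary k x
    rw [leftSpan_tmul, leftAdjoint_apply r, inclRight_apply, twistRight_tmul _ r, Finset.sum_mul,
      map_sum]
    exact Finset.sum_congr rfl fun i _ => by simp [opRight, mulRightAntipodeHom]

theorem rightSpan_leftAdjoint (z : H ⊗[k] H) :
    rightSpan (leftAdjoint k H) (inclRight k H) z =
      opRight k H (twistRight
        (WithConv.toConv ((mulLeftHom k H).toLinearMap ∘ₗ antipode k)) z) := by
  induction z with
  | zero => simp
  | add z z' hz hz' => simp only [map_add, hz, hz']
  | tmul x y =>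
    let r := Repr.arbitrary k x
    rw [rightSpan_tmul, leftAdjoint_apply r, inclRight_apply, twistRight_tmul _ r, Finset.mul_sum,
      map_sum]
    exact Finset.sum_congr rfl fun i _ => by simp [opRight, mulLeftHom]

theorem leftSpan_rightAdjoint (z : Hᵐᵒᵖ ⊗[k] H) :
    leftSpan (rightAdjoint k H) (inclLeft k H) z =
      opRight k H (twistLeft (WithConv.toConv (mulLeftAntipodeHom k H).toLinearMap)
        (unopSwap k H z)) := by
  induction z with
  | zero => simp
  | add z z' hz hz' => simp only [map_add, hz, hz']
  | tmul x y =>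
    let r := Repr.arbitrary k x.unop
    rw [leftSpan_tmul, ← MulOpposite.op_unop x, rightAdjoint_apply r, inclLeft_apply]
    change _ = opRight k H (twistLeft _ (y ⊗ₜ x.unop))
    rw [twistLeft_tmul _ r, Finset.sum_mul, map_sum]
    exact Finset.sum_congr rfl fun i _ => by simp [opRight, mulLeftAntipodeHom]

theorem rightSpan_rightAdjoint (z : Hᵐᵒᵖ ⊗[k] H) :
    rightSpan (rightAdjoint k H) (inclLeft k H) z =
      opRight k H (twistLeft (WithConv.toConv ((mulRightHom k H).toLinearMap ∘ₗ antipode k))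
        (unopSwap k H z)) := by
  induction z with
  | zero => simp
  | add z z' hz hz' => simp only [map_add, hz, hz']
  | tmul x y =>
    let r := Repr.arbitrary k x.unop
    rw [rightSpan_tmul, ← MulOpposite.op_unop x, rightAdjoint_apply r, inclLeft_apply]
    change _ = opRight k H (twistLeft _ (y ⊗ₜ x.unop))
    rw [twistLeft_tmul _ r, Finset.mul_sum, map_sum]
    exact Finset.sum_congr rfl fun i _ => by simp [opRight, mulRightHom]

variable (k H)

theorem leftSpan_leftAdjoint_bijective :
    Function.Bijective (leftSpan (leftAdjoint k H) (inclRight k H)) := by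
  rw [funext leftSpan_leftAdjoint]
  exact (opRight k H).bijective.comp
    (twistRight_bijective (conv_mul_antipode _) (conv_antipode_mul _))

theorem rightSpan_leftAdjoint_bijective :
    Function.Bijective (rightSpan (leftAdjoint k H) (inclRight k H)) := by
  rw [funext rightSpan_leftAdjoint]
  exact (opRight k H).bijective.comp
    (twistRight_bijective (conv_antipode_mul _) (conv_mul_antipode _))

theorem leftSpan_rightAdjoint_bijective :
    Function.Bijective (leftSpan (rightAdjoint k H) (inclLeft k H)) := by
  rw [funext leftSpan_rightAdjoint]
  exact (opRight k H).bijective.comp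
    ((twistLeft_bijective (conv_mul_antipode _) (conv_antipode_mul _)).comp
      (unopSwap k H).bijective)

theorem rightSpan_rightAdjoint_bijective :
    Function.Bijective (rightSpan (rightAdjoint k H) (inclLeft k H)) := by
  rw [funext rightSpan_rightAdjoint]
  exact (opRight k H).bijective.comp
    ((twistLeft_bijective (conv_antipode_mul _) (conv_mul_antipode _)).comp
      (unopSwap k H).bijective)

variable {k H}

/-- In the enveloping algebra, `(1 ⊗ y)(a ⊗ b) = (a₁ ⊗ S(a₂))(1 ⊗ b y S²(a₃))`. -/
theorem inclRight_mul (y a b : H) :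
    inclRight k H y * (a ⊗ₜ MulOpposite.op b) = leftSpan (leftAdjoint k H) (inclRight k H)
      (twistRight (WithConv.toConv ((mulRightAntipodeHom k H).toLinearMap ∘ₗ antipode k))
        (a ⊗ₜ (b * y))) := by
  rw [leftSpan_leftAdjoint, ← LinearMap.comp_apply (twistRight _), ← twistRight_mul,
    conv_mul_antipode, twistRight_one]
  simp [inclRight_apply, opRight]

/-- In the enveloping algebra, `(x ⊗ 1)(a ⊗ b) = (S(b₂) ⊗ b₃)(S²(b₁) x a ⊗ 1)`. -/
theorem inclLeft_mul (x a b : H) :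
    inclLeft k H x * (a ⊗ₜ MulOpposite.op b) = leftSpan (rightAdjoint k H) (inclLeft k H)
      ((unopSwap k H).symm (twistLeft
        (WithConv.toConv ((mulLeftAntipodeHom k H).toLinearMap ∘ₗ antipode k))
        ((x * a) ⊗ₜ b))) := by
  rw [leftSpan_rightAdjoint, LinearEquiv.apply_symm_apply, ← LinearMap.comp_apply (twistLeft _),
    ← twistLeft_mul, conv_antipode_mul, twistLeft_one]
  simp [inclLeft_apply, opRight]

theorem rTensor_twistRight (χ : H →ₐ[k] k) (a y : H) :
    TensorProduct.lid k H (χ.toLinearMap.rTensor H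
      (twistRight (WithConv.toConv ((mulRightAntipodeHom k H).toLinearMap ∘ₗ antipode k))
        (a ⊗ₜ y))) = y * antipode k (antipode k (leftWindingHom k χ a)) := by
  let r := Repr.arbitrary k a
  have h : leftWindingHom k χ a = ∑ i ∈ r.index, χ (r.left i) • r.right i := by
    simp [leftWindingHom, ← r.eq]
  rw [twistRight_tmul _ r, h]
  simp [mulRightAntipodeHom, Finset.mul_sum]

theorem rTensor_twistLeft (χ : Hᵐᵒᵖ →ₐ[k] k) (χ' : H →ₐ[k] k)
    (hχ : ∀ h, χ (MulOpposite.op h) = χ' h) (b x : H) :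
    TensorProduct.lid k H (χ.toLinearMap.rTensor H ((unopSwap k H).symm
      (twistLeft (WithConv.toConv ((mulLeftAntipodeHom k H).toLinearMap ∘ₗ antipode k))
        (x ⊗ₜ b)))) = antipode k (antipode k (rightWindingHom k χ' b)) * x := by
  let r := Repr.arbitrary k b
  have h : rightWindingHom k χ' b = ∑ i ∈ r.index, χ' (r.right i) • r.left i := by
    simp [rightWindingHom, ← r.eq]
  rw [twistLeft_tmul _ r, h]
  simp [mulLeftAntipodeHom, Finset.sum_mul, unopSwap, hχ]

end Antipode

/-! ### The bimodule `Ext` of a Hopf algebra -/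

/-- Postcomposition with an isomorphism, as a linear equivalence of `Ext` groups. -/
def extPostcompIso {R C : Type*} [CommRing R] [Category* C] [Abelian C] [Linear R C] [HasExt.{u} C]
    {X Y Z : C} (i : Y ≅ Z) (n : ℕ) : Ext.{u} X Y n ≃ₗ[R] Ext.{u} X Z n where
  toFun x := x.comp (Ext.mk₀ i.hom) (add_zero n)
  invFun x := x.comp (Ext.mk₀ i.inv) (add_zero n)
  map_add' _ _ := Ext.add_comp _ _ _ _
  map_smul' _ _ := Ext.smul_comp _ _ _ _
  left_inv x := by
    dsimp only
    rw [Ext.comp_assoc _ _ _ (add_zero n) (add_zero 0) (by omega), Ext.mk₀_comp_mk₀,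
      i.hom_inv_id, Ext.comp_mk₀_id]
  right_inv x := by
    dsimp only
    rw [Ext.comp_assoc _ _ _ (add_zero n) (add_zero 0) (by omega), Ext.mk₀_comp_mk₀,
      i.inv_hom_id, Ext.comp_mk₀_id]

section Bimodule

variable {k H : Type u} [Field k] [Ring H] [HopfAlgebra k H]

-- `a ⊗ b` acts on `H` by `x ↦ a x b`
attribute [local instance] instModuleTensorProductMop

theorem bimodule_smul (a b x : H) :
    (a ⊗ₜ[k] MulOpposite.op b) • x = a * (x * b) := rfl

variable {M : Type u} [AddCommGroup M] [Module (H ⊗[k] Hᵐᵒᵖ) M]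

/-- A bimodule map out of `H` is determined by the image of `1`. -/
theorem bimodule_hom_ext {f g : H →ₗ[H ⊗[k] Hᵐᵒᵖ] M} (h : f 1 = g 1) : f = g := by
  ext x
  have hx : x = (x ⊗ₜ[k] MulOpposite.op (1 : H)) • (1 : H) := by
    rw [bimodule_smul, one_mul, mul_one]
  rw [hx, map_smul, map_smul, h]

/-- A central element of a bimodule is the image of `1` under a bimodule map out of `H`. -/
theorem exists_bimodule_hom (m : M)
    (hm : ∀ b : H, (b ⊗ₜ[k] (1 : Hᵐᵒᵖ)) • m = ((1 : H) ⊗ₜ[k] MulOpposite.op b) • m) :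
    ∃ f : H →ₗ[H ⊗[k] Hᵐᵒᵖ] M, f 1 = m := by
  let g : H →+ M :=
    { toFun := fun a => (a ⊗ₜ[k] (1 : Hᵐᵒᵖ)) • m
      map_zero' := by
        rw [TensorProduct.zero_tmul]
        exact zero_smul (H ⊗[k] Hᵐᵒᵖ) m
      map_add' := fun a b => by rw [TensorProduct.add_tmul, add_smul] }
  have hg (a : H) : g a = (a ⊗ₜ[k] (1 : Hᵐᵒᵖ)) • m := rfl
  let f : H →ₗ[H ⊗[k] Hᵐᵒᵖ] M :=
    { toFun := g
      map_add' := g.map_add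
      map_smul' := fun c x => by
        rw [RingHom.id_apply]
        induction c with
        | zero =>
          exact ((congrArg g (zero_smul (H ⊗[k] Hᵐᵒᵖ) x)).trans (map_zero g)).trans (zero_smul (H ⊗[k] Hᵐᵒᵖ) (g x)).symm
        | add c c' h h' => rw [add_smul, add_smul, ← h, ← h', map_add]
        | tmul a b =>
          rw [← MulOpposite.op_unop b, bimodule_smul, hg, hg, ← mul_assoc]
          have h1 : (a * x * b.unop) ⊗ₜ[k] (1 : Hᵐᵒᵖ) =
              (a * x) ⊗ₜ[k] (1 : Hᵐᵒᵖ) * (b.unop ⊗ₜ[k] (1 : Hᵐᵒᵖ)) := by simp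
          rw [h1, mul_smul, hm, smul_smul, smul_smul]
          simp }
  refine ⟨f, ?_⟩
  change ((1 : H) ⊗ₜ[k] (1 : Hᵐᵒᵖ)) • m = m
  rw [← Algebra.TensorProduct.one_def, one_smul]

/-- An element on which the left adjoint action is trivial is central. -/
theorem smul_eq_of_leftAdjoint (m : M)
    (hm : ∀ h : H, leftAdjoint k H h • m = (algebraMap k (H ⊗[k] Hᵐᵒᵖ) (counit h)) • m) (b : H) :
    (b ⊗ₜ[k] (1 : Hᵐᵒᵖ)) • m = ((1 : H) ⊗ₜ[k] MulOpposite.op b) • m := by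
  -- `b ⊗ 1 = (1 ⊗ b₃)(b₁ ⊗ S(b₂))`
  have hspan : rightSpan (leftAdjoint k H) (inclRight k H) (comul b) =
      b ⊗ₜ[k] (1 : Hᵐᵒᵖ) := by
    have h : comul b = twistRight (WithConv.toConv (mulLeftHom k H).toLinearMap)
        (b ⊗ₜ[k] (1 : H)) := by
      let r := Repr.arbitrary k b
      rw [twistRight_tmul _ r, ← r.eq]
      simp [mulLeftHom]
    rw [h, rightSpan_leftAdjoint, ← LinearMap.comp_apply (twistRight _), ← twistRight_mul,
      conv_antipode_mul, twistRight_one]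
    simp [opRight]
  let r := Repr.arbitrary k b
  have hb : b = ∑ i ∈ r.index, counit (R := k) (r.left i) • r.right i :=
    (sum_counit_smul r).symm
  rw [← hspan, ← r.eq, map_sum, Finset.sum_smul]
  simp only [rightSpan_tmul, mul_smul, hm]
  conv_rhs => rw [hb]
  rw [Finset.op_sum, TensorProduct.tmul_sum, Finset.sum_smul]
  refine Finset.sum_congr rfl fun i _ => ?_
  rw [smul_smul, inclRight_apply, ← Algebra.commutes, ← Algebra.smul_def]
  simp

/-- An element on which the right adjoint action is trivial is central. -/
theorem smul_eq_of_rightAdjoint (m : M)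
    (hm : ∀ h : H, rightAdjoint k H (MulOpposite.op h) • m =
      (algebraMap k (H ⊗[k] Hᵐᵒᵖ) (counit h)) • m) (b : H) :
    (b ⊗ₜ[k] (1 : Hᵐᵒᵖ)) • m = ((1 : H) ⊗ₜ[k] MulOpposite.op b) • m := by
  -- `1 ⊗ b = (b₁ ⊗ 1)(S(b₂) ⊗ b₃)`
  have hspan : rightSpan (rightAdjoint k H) (inclLeft k H) ((unopSwap k H).symm (comul b)) =
      (1 : H) ⊗ₜ[k] MulOpposite.op b := by
    have h : comul b = twistLeft (WithConv.toConv (mulRightHom k H).toLinearMap)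
        ((1 : H) ⊗ₜ[k] b) := by
      let r := Repr.arbitrary k b
      rw [twistLeft_tmul _ r, ← r.eq]
      simp [mulRightHom]
    rw [h, rightSpan_rightAdjoint, LinearEquiv.apply_symm_apply,
      ← LinearMap.comp_apply (twistLeft _), ← twistLeft_mul,
      conv_mul_antipode, twistLeft_one]
    simp [opRight]
  let r := Repr.arbitrary k b
  have hb : b = ∑ i ∈ r.index, counit (R := k) (r.right i) • r.left i := by
    have h := congrArg (TensorProduct.rid k H) (sum_tmul_counit_eq r)
    simp only [map_sum, TensorProduct.rid_tmul, one_smul] at h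
    exact h.symm
  rw [← hspan, ← r.eq, map_sum, map_sum, Finset.sum_smul]
  have hz (i) : rightSpan (rightAdjoint k H) (inclLeft k H)
      ((unopSwap k H).symm (r.left i ⊗ₜ[k] r.right i)) =
      inclLeft k H (r.left i) * rightAdjoint k H (MulOpposite.op (r.right i)) := rfl
  simp only [hz, mul_smul, hm]
  conv_lhs => rw [hb]
  rw [TensorProduct.sum_tmul, Finset.sum_smul]
  refine Finset.sum_congr rfl fun i _ => ?_
  rw [smul_smul, inclLeft_apply, ← Algebra.commutes, ← Algebra.smul_def]
  simp [TensorProduct.smul_tmul']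

theorem leftAdjoint_smul_one (h : H) :
    leftAdjoint k H h • (1 : H) = algebraMap k H (counit h) := by
  let r := Repr.arbitrary k h
  rw [leftAdjoint_apply r, Finset.sum_smul, ← sum_mul_antipode_eq_algebraMap_counit r]
  simp only [bimodule_smul, one_mul]

theorem rightAdjoint_smul_one (h : H) :
    rightAdjoint k H (MulOpposite.op h) • (1 : H) = algebraMap k H (counit h) := by
  let r := Repr.arbitrary k h
  rw [rightAdjoint_apply r, Finset.sum_smul, ← sum_antipode_mul_eq_algebraMap_counit r]
  simp only [bimodule_smul, one_mul]

theorem algebraMap_smul_bimodule (c : k) (x : H) :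
    algebraMap k (H ⊗[k] Hᵐᵒᵖ) c • x = algebraMap k H c * x := by
  rw [Algebra.TensorProduct.algebraMap_apply, ← MulOpposite.op_one, bimodule_smul, mul_one]

section Unit

variable {B : Type u} [Ring B] [Algebra k B] (ε : B →ₐ[k] k)

/-- The one-dimensional module given by a character. -/
def characterModule : ModuleCat.{u} B :=
  (ModuleCat.restrictScalars (ε : B →+* k)).obj (ModuleCat.of k k)

instance : Module.Finite B (characterModule ε) :=
  Module.Finite.of_surjective
    (LinearMap.toSpanSingleton B (characterModule ε) (1 : k)) fun c : k => by
      refine ⟨algebraMap k B c, ?_⟩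
      exact (mul_one (ε (algebraMap k B c))).trans (ε.commutes c)

variable {ε} {δ : B →ₐ[k] H ⊗[k] Hᵐᵒᵖ} (hδ : ∀ b, δ b • (1 : H) = algebraMap k H (ε b))

/-- The unit `k → H` as a map of `B`-modules, when `B` acts on the image of the unit through the
character `ε`. -/
def unitHom : characterModule ε ⟶
    (ModuleCat.restrictScalars.{u} δ.toRingHom).obj (ModuleCat.of (H ⊗[k] Hᵐᵒᵖ) H) :=
  ModuleCat.ofHom (X := characterModule ε)
    (Y := (ModuleCat.restrictScalars.{u} δ.toRingHom).obj (ModuleCat.of (H ⊗[k] Hᵐᵒᵖ) H))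
    { toFun := fun c : k => algebraMap k H c
      map_add' := fun c c' => map_add (algebraMap k H) c c'
      map_smul' := fun b (c : k) => by
        change algebraMap k H (ε b * c) = δ b • algebraMap k H c
        have hc : algebraMap k H c = algebraMap k (H ⊗[k] Hᵐᵒᵖ) c • (1 : H) := by
          rw [algebraMap_smul_bimodule, mul_one]
        rw [hc, smul_smul, ← Algebra.commutes, mul_smul, hδ, algebraMap_smul_bimodule, mul_comm,
          map_mul] }

/-- If every element on which `B` acts through `ε` is central, then bimodule maps out of `H` are the
same as `B`-module maps out of the one-dimensional module given by `ε`. -/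
theorem unitHom_bijective
    (hcomm : ∀ (M : ModuleCat.{u} (H ⊗[k] Hᵐᵒᵖ)) (m : M),
      (∀ b, δ b • m = algebraMap k (H ⊗[k] Hᵐᵒᵖ) (ε b) • m) →
      ∀ h : H, (h ⊗ₜ[k] (1 : Hᵐᵒᵖ)) • m = ((1 : H) ⊗ₜ[k] MulOpposite.op h) • m)
    (M : ModuleCat.{u} (H ⊗[k] Hᵐᵒᵖ)) :
    Function.Bijective fun f : ModuleCat.of (H ⊗[k] Hᵐᵒᵖ) H ⟶ M =>
      unitHom hδ ≫ (ModuleCat.restrictScalars.{u} δ.toRingHom).map f := by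
  constructor
  · intro f g h
    apply ModuleCat.hom_ext
    apply bimodule_hom_ext
    have h1 : f.hom (algebraMap k H 1) = g.hom (algebraMap k H 1) :=
      congrArg (fun φ => φ.hom (1 : k)) h
    rwa [map_one] at h1
  · intro φ
    let ψ : k → M := fun c => φ.hom c
    have h0 (b : B) : ψ (ε b) = δ b • ψ 1 := by
      have h1 : ψ (ε b * 1) = δ b • ψ 1 := φ.hom.map_smul b (1 : k)
      rwa [mul_one] at h1
    have hφ (c : k) : ψ c = algebraMap k (H ⊗[k] Hᵐᵒᵖ) c • ψ 1 := by
      have h1 := h0 (algebraMap k B c)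
      rw [AlgHom.commutes, AlgHom.commutes] at h1
      exact h1
    obtain ⟨f, hf⟩ := exists_bimodule_hom (ψ 1)
      (hcomm M (ψ 1) fun b => by rw [← h0, ← hφ])
    refine ⟨ModuleCat.ofHom f, ?_⟩
    apply ModuleCat.hom_ext
    refine LinearMap.ext fun c : k => ?_
    change f (algebraMap k H c) = ψ c
    have hc : algebraMap k H c = algebraMap k (H ⊗[k] Hᵐᵒᵖ) c • (1 : H) := by
      rw [algebraMap_smul_bimodule, mul_one]
    rw [hφ, hc, map_smul, hf]

end Unit

variable (k H)

/-- The group `Ext` of bimodules from `H` to the enveloping algebra, with its remaining right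
module structure, computed through left modules: it is `H` with the elements of the enveloping
algebra acting by `y · (a ⊗ b) = b y S²(ξ(a))`, where `ξ` is the left winding by the character of
the left integral. -/
theorem exists_ext_equiv_left [IsNoetherianRing H] {d : ℕ}
    (h1 : Module.finrank k (LeftExt k H d) = 1) {χ : H →ₐ[k] k}
    (hχ : IsLeftIntegralCharacter d χ) :
    ∃ J : H ≃+ Ext.{u} (ModuleCat.of (H ⊗[k] Hᵐᵒᵖ) H)
        (ModuleCat.of (H ⊗[k] Hᵐᵒᵖ) (H ⊗[k] Hᵐᵒᵖ)) d,
      ∀ y a b : H, (J y).comp (Ext.mk₀ (rightMul (a ⊗ₜ MulOpposite.op b))) (add_zero d) =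
        J (b * y * antipode k (antipode k (leftWindingHom k χ a))) := by
  obtain ⟨e, he, hspan⟩ := finrank_eq_one_iff'.1 h1
  have hbij : Function.Bijective fun c : k => c • e :=
    ⟨smul_left_injective k he, hspan⟩
  let K : ModuleCat.{u} H := characterModule (Bialgebra.counitAlgHom k H)
  have : Module.Finite H K := inferInstance
  obtain ⟨J, hJ⟩ := exists_ext_equiv (K := K) (e := e) (leftAdjoint k H) (inclRight k H)
    (leftSpan_leftAdjoint_bijective k H) (rightSpan_leftAdjoint_bijective k H)
    (χ := χ) (fun b => hχ e b) hbij (unitHom (ε := Bialgebra.counitAlgHom k H) leftAdjoint_smul_one)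
    (unitHom_bijective _ fun M m hm => smul_eq_of_leftAdjoint m hm)
  refine ⟨J, fun y a b => ?_⟩
  rw [hJ y _ _ (inclRight_mul y a b), rTensor_twistRight]

/-- The same group computed through right modules: it is `H` with action
`x · (a ⊗ b) = S²(φ(b)) x a`, where `φ` is the right winding by the character of the right
integral. -/
theorem exists_ext_equiv_right [IsNoetherianRing Hᵐᵒᵖ] {d : ℕ}
    (h1 : Module.finrank k (RightExt k H d) = 1) :
    ∃ (χ : H →ₐ[k] k) (J : H ≃+ Ext.{u} (ModuleCat.of (H ⊗[k] Hᵐᵒᵖ) H)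
        (ModuleCat.of (H ⊗[k] Hᵐᵒᵖ) (H ⊗[k] Hᵐᵒᵖ)) d),
      ∀ x a b : H, (J x).comp (Ext.mk₀ (rightMul (a ⊗ₜ MulOpposite.op b))) (add_zero d) =
        J (antipode k (antipode k (rightWindingHom k χ b)) * (x * a)) := by
  let ε : Hᵐᵒᵖ →ₐ[k] k :=
    (Bialgebra.counitAlgHom k H).fromOpposite (fun _ _ => Commute.all _ _)
  let K : ModuleCat.{u} Hᵐᵒᵖ := characterModule ε
  let i : ModuleCat.of Hᵐᵒᵖ H ≅ ModuleCat.of Hᵐᵒᵖ Hᵐᵒᵖ :=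
    LinearEquiv.toModuleIso
      { MulOpposite.opAddEquiv with
        map_smul' := fun _ _ => rfl }
  have h2 : Module.finrank k (Ext.{u} K (ModuleCat.of Hᵐᵒᵖ Hᵐᵒᵖ) d) = 1 := by
    exact (extPostcompIso (R := k) (X := K) i d).finrank_eq.symm.trans h1
  obtain ⟨χ, hχ⟩ := exists_character K d h2
  obtain ⟨e, he, hspan⟩ := finrank_eq_one_iff'.1 h2
  have hbij : Function.Bijective fun c : k => c • e :=
    ⟨smul_left_injective k he, hspan⟩
  have : Module.Finite Hᵐᵒᵖ K := inferInstanceAs (Module.Finite Hᵐᵒᵖ (characterModule ε))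
  let χ' : H →ₐ[k] k := AlgHom.ofLinearMap
    (χ.toLinearMap ∘ₗ (MulOpposite.opLinearEquiv k).toLinearMap) (by simp)
    (fun x y => by simp [mul_comm])
  obtain ⟨J, hJ⟩ := exists_ext_equiv (K := K) (e := e) (rightAdjoint k H) (inclLeft k H)
    (leftSpan_rightAdjoint_bijective k H) (rightSpan_rightAdjoint_bijective k H)
    (χ := χ) (fun b => hχ e b) hbij
    (unitHom (ε := ε) fun b => rightAdjoint_smul_one b.unop)
    (unitHom_bijective _ fun M m hm => smul_eq_of_rightAdjoint m fun h => hm (MulOpposite.op h))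
  refine ⟨χ', J, fun x a b => ?_⟩
  rw [hJ x _ _ (inclLeft_mul x a b), rTensor_twistLeft χ χ' fun _ => rfl]

end Bimodule

/-! ### Windings, the antipode and the comparison -/

section WindingAntipode

variable {k H : Type u} [Field k] [Ring H] [HopfAlgebra k H]

theorem characterToSelf_injective {χ ψ : H →ₐ[k] k}
    (h : WithConv.toConv (characterToSelf k χ).toLinearMap =
      WithConv.toConv (characterToSelf k ψ).toLinearMap) : χ = ψ := by
  ext a
  have h1 := LinearMap.congr_fun (WithConv.toConv_injective h) a
  simpa [characterToSelf, Algebra.ofId_apply] using congrArg (counit (R := k)) h1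

theorem eq_characterAntipode {χ ψ : H →ₐ[k] k}
    (h : WithConv.toConv (characterToSelf k χ).toLinearMap *
      WithConv.toConv (characterToSelf k ψ).toLinearMap = 1) : ψ = characterAntipode k χ :=
  characterToSelf_injective (left_inv_eq_right_inv (antipode_mul_character k χ) h).symm

theorem characterAntipode_characterAntipode (χ : H →ₐ[k] k) :
    characterAntipode k (characterAntipode k χ) = χ :=
  (eq_characterAntipode (antipode_mul_character k χ)).symm

/-- Both sides are the convolution inverse of the right winding by `χ`. -/
theorem rightWindingHom_antipode (χ : H →ₐ[k] k) (a : H) :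
    rightWindingHom k χ (antipode k a) =
      antipode k (leftWindingHom k (characterAntipode k χ) a) := by
  have h1 := conv_antipode_mul (rightWindingHom k χ)
  have h2 : WithConv.toConv (rightWindingHom k χ).toLinearMap *
      WithConv.toConv (antipode k ∘ₗ (leftWindingHom k (characterAntipode k χ)).toLinearMap) =
        1 := by
    have h3 : WithConv.toConv
        (antipode k ∘ₗ (leftWindingHom k (characterAntipode k χ)).toLinearMap) =
        WithConv.toConv (characterToSelf k (characterAntipode k χ)).toLinearMap *
          WithConv.toConv (antipode k (A := H)) := by
      ext a
      let r := Repr.arbitrary k a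
      rw [r.convMul_apply]
      have h : leftWindingHom k (characterAntipode k χ) a =
          ∑ i ∈ r.index, characterAntipode k χ (r.left i) • r.right i := by
        simp [leftWindingHom, ← r.eq]
      simp only [LinearMap.comp_apply, AlgHom.toLinearMap_apply, h, map_sum, map_smul]
      simp [characterToSelf, Algebra.ofId_apply, Algebra.smul_def]
    rw [h3, toConv_rightWindingHom, mul_assoc, ← mul_assoc (WithConv.toConv
      (characterToSelf k χ).toLinearMap), character_mul_antipode, one_mul,
      LinearMap.id_mul_antipode]
  exact LinearMap.congr_fun (WithConv.toConv_injective (left_inv_eq_right_inv h1 h2)) a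

/-- Both sides are the convolution inverse of the left winding by `χ`. -/
theorem leftWindingHom_antipode (χ : H →ₐ[k] k) (a : H) :
    leftWindingHom k χ (antipode k a) =
      antipode k (rightWindingHom k (characterAntipode k χ) a) := by
  have h1 := conv_mul_antipode (leftWindingHom k χ)
  have h2 : WithConv.toConv (antipode k ∘ₗ
      (rightWindingHom k (characterAntipode k χ)).toLinearMap) *
        WithConv.toConv (leftWindingHom k χ).toLinearMap = 1 := by
    have h3 : WithConv.toConv
        (antipode k ∘ₗ (rightWindingHom k (characterAntipode k χ)).toLinearMap) =
        WithConv.toConv (antipode k (A := H)) *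
          WithConv.toConv (characterToSelf k (characterAntipode k χ)).toLinearMap := by
      ext a
      let r := Repr.arbitrary k a
      rw [r.convMul_apply]
      have h : rightWindingHom k (characterAntipode k χ) a =
          ∑ i ∈ r.index, characterAntipode k χ (r.right i) • r.left i := by
        simp [rightWindingHom, ← r.eq]
      simp only [LinearMap.comp_apply, AlgHom.toLinearMap_apply, h, map_sum, map_smul]
      simp [characterToSelf, Algebra.ofId_apply, Algebra.smul_def, Algebra.commutes]
    rw [h3, toConv_leftWindingHom, mul_assoc, ← mul_assoc (WithConv.toConv
      (characterToSelf k (characterAntipode k χ)).toLinearMap), antipode_mul_character, one_mul,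
      LinearMap.antipode_mul_id]
  exact (LinearMap.congr_fun (WithConv.toConv_injective (left_inv_eq_right_inv h2 h1)) a).symm

theorem rightWindingHom_antipode_antipode (χ : H →ₐ[k] k) (a : H) :
    rightWindingHom k χ (antipode k (antipode k a)) =
      antipode k (antipode k (rightWindingHom k χ a)) := by
  rw [rightWindingHom_antipode, leftWindingHom_antipode, characterAntipode_characterAntipode]

theorem rightWindingHom_leftWindingHom (χ ψ : H →ₐ[k] k) (a : H) :
    rightWindingHom k χ (leftWindingHom k ψ a) = leftWindingHom k ψ (rightWindingHom k χ a) := by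
  have h1 := LinearMap.algHom_comp_convMul_distrib (rightWindingHom k χ)
    (WithConv.toConv (characterToSelf k ψ).toLinearMap)
    (WithConv.toConv (LinearMap.id : H →ₗ[k] H))
  have h2 := LinearMap.algHom_comp_convMul_distrib (leftWindingHom k ψ)
    (WithConv.toConv (LinearMap.id : H →ₗ[k] H))
    (WithConv.toConv (characterToSelf k χ).toLinearMap)
  rw [← toConv_leftWindingHom] at h1
  rw [← toConv_rightWindingHom] at h2
  have fix (f : H →ₐ[k] H) (χ : H →ₐ[k] k) :
      f.toLinearMap ∘ₗ (characterToSelf k χ).toLinearMap = (characterToSelf k χ).toLinearMap := by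
    ext a
    simp [characterToSelf, Algebra.ofId_apply]
  simp only [LinearMap.comp_id, fix] at h1 h2
  rw [toConv_rightWindingHom, ← mul_assoc] at h1
  rw [toConv_leftWindingHom] at h2
  exact LinearMap.congr_fun (h1.trans h2.symm) a

theorem counit_rightWindingHom (χ : H →ₐ[k] k) (a : H) :
    counit (R := k) (rightWindingHom k χ a) = χ a := by
  let r := Repr.arbitrary k a
  have h : rightWindingHom k χ a = ∑ i ∈ r.index, χ (r.right i) • r.left i := by
    simp [rightWindingHom, ← r.eq]
  have h' := congrArg (TensorProduct.lid k k ∘ TensorProduct.map LinearMap.id χ.toLinearMap)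
    (sum_counit_tmul_eq r)
  simp only [Function.comp_apply, map_sum, TensorProduct.map_tmul, TensorProduct.lid_tmul,
    LinearMap.id_apply, AlgHom.toLinearMap_apply, smul_eq_mul, one_mul] at h'
  rw [h, ← h']
  simp [mul_comm]

/-- The two descriptions of one bimodule as a twist of `H` force `S⁴` to be the composite of the
windings up to an inner automorphism. -/
theorem exists_inner_of_twist_equiv [IsNoetherianRing H] (χ χ' : H →ₐ[k] k) (θ : H ≃+ H)
    (hθ : ∀ a b y : H, θ (b * y * antipode k (antipode k (leftWindingHom k χ a))) =
      antipode k (antipode k (rightWindingHom k χ' b)) * (θ y * a)) :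
    ∃ v : Hˣ, ∀ a : H, antipode k (antipode k (antipode k (antipode k a))) =
      v * rightWinding k χ ((leftWinding k χ).symm a) * ↑v⁻¹ := by
  have h1 (b : H) : θ b = antipode k (antipode k (rightWindingHom k χ' b)) * θ 1 := by
    simpa using hθ 1 b 1
  have h2 (a : H) : θ (antipode k (antipode k (leftWindingHom k χ a))) = θ 1 * a := by
    simpa using hθ a 1 1
  -- surjectivity of `θ` makes `θ 1` left invertible, hence invertible as `H` is noetherian
  obtain ⟨b, hb⟩ := θ.surjective 1
  rw [h1] at hb
  let v : Hˣ := ⟨θ 1, _, mul_eq_one_symm hb, hb⟩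
  have hv : (v : H) = θ 1 := rfl
  have key (a : H) : antipode k (antipode k (antipode k (antipode k
      (rightWindingHom k χ' (leftWindingHom k χ a))))) = v * a * ↑v⁻¹ := by
    rw [Units.eq_mul_inv_iff_mul_eq, hv, ← h2, h1 (antipode k _),
      rightWindingHom_antipode_antipode]
  -- applying the counit identifies the two characters as inverse to each other
  have hχ : WithConv.toConv (characterToSelf k χ).toLinearMap *
      WithConv.toConv (characterToSelf k χ').toLinearMap = 1 := by
    ext a
    let r := Repr.arbitrary k a
    have h3 := congrArg (counit (R := k)) (key a)
    have h4 : leftWindingHom k χ a = ∑ i ∈ r.index, χ (r.left i) • r.right i := by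
      simp [leftWindingHom, ← r.eq]
    have h5 : counit (R := k) (v : H) * counit (R := k) ((v⁻¹ : Hˣ) : H) = 1 := by
      rw [← Bialgebra.counit_mul, Units.mul_inv, Bialgebra.counit_one]
    rw [counit_antipode, counit_antipode, counit_antipode, counit_antipode,
      counit_rightWindingHom, Bialgebra.counit_mul, Bialgebra.counit_mul, mul_right_comm, h5,
      one_mul, h4, map_sum] at h3
    rw [r.convMul_apply]
    simp only [map_smul, smul_eq_mul] at h3
    simp [characterToSelf, Algebra.ofId_apply, LinearMap.convOne_def, ← h3]
  obtain rfl := eq_characterAntipode hχ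
  refine ⟨v, fun a => ?_⟩
  have h6 := key ((leftWinding k χ).symm (rightWinding k χ a))
  have h7 : leftWindingHom k χ ((leftWinding k χ).symm (rightWinding k χ a)) =
    rightWinding k χ a := (leftWinding k χ).apply_symm_apply _
  have h8 : rightWindingHom k (characterAntipode k χ) (rightWinding k χ a) = a :=
    (rightWinding k χ).symm_apply_apply a
  rw [h7, h8] at h6
  rw [h6]
  congr 2
  exact (rightWindingHom_leftWindingHom χ (characterAntipode k χ) a).symm

end WindingAntipode

theorem existsUnique_integralCharacter {k H : Type u} [Field k] [Ring H] [HopfAlgebra k H] {d : ℕ}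
    (h : Module.finrank k (LeftExt k H d) = 1) :
    ∃! χ : H →ₐ[k] k, IsLeftIntegralCharacter d χ := by
  obtain ⟨χ, hχ⟩ := exists_character (trivialLeft k H) d h
  refine ⟨χ, fun e b => hχ e b, fun ψ hψ => ?_⟩
  obtain ⟨e, he, -⟩ := finrank_eq_one_iff'.1 h
  ext a
  exact smul_left_injective k he ((hψ e a).symm.trans (hχ e a))

end ASHopf

end

theorem theorem3p1 (k H : Type u) [Field k] [Ring H] [HopfAlgebra k H]
    [IsNoetherianRing H] [IsNoetherianRing Hᵐᵒᵖ]
    (d : ℕ) (hH : ASHopf.IsASGorenstein k H d) :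
    (∃! χ : H →ₐ[k] k, ASHopf.IsLeftIntegralCharacter d χ) ∧
    ∀ χ : H →ₐ[k] k, ASHopf.IsLeftIntegralCharacter d χ →
      ∃ γ : H ≃ₐ[k] H, ASHopf.IsInnerAut k γ ∧
        ∀ a : H,
          HopfAlgebra.antipode k (HopfAlgebra.antipode k
            (HopfAlgebra.antipode k (HopfAlgebra.antipode k a))) =
            γ (ASHopf.rightWinding k χ ((ASHopf.leftWinding k χ).symm a)) := by
  refine ⟨ASHopf.existsUnique_integralCharacter hH.finrank_left, fun χ hχ => ?_⟩
  obtain ⟨J, hJ⟩ := ASHopf.exists_ext_equiv_left k H hH.finrank_left hχ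
  obtain ⟨χ', J', hJ'⟩ := ASHopf.exists_ext_equiv_right k H hH.finrank_right
  obtain ⟨v, hv⟩ := ASHopf.exists_inner_of_twist_equiv χ χ' (J.trans J'.symm) fun a b y => by
    apply J'.injective
    rw [← hJ', AddEquiv.trans_apply, AddEquiv.trans_apply, J'.apply_symm_apply,
      J'.apply_symm_apply, hJ]
  exact ⟨MulSemiringAction.toAlgEquiv k H (ConjAct.toConjAct v), ⟨v, fun a => rfl⟩, hv⟩
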